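/- Let $A$ be a finite set, $\mathcal H$ a Hilbert space of dimension $d$ with $1\le d<\infty$, $\mathcal B=\mathcal L(\mathcal H)$, and let $\mathcal B^{\mathbb Z}$ be the quasi-local $C^*$-algebra built from $\mathcal B$, i.e. the norm completion of $\bigcup_{\Lambda\subset\mathbb Z,\,|\Lambda|<\infty}\bigotimes_{n\in\Lambda}\mathcal B$ (with the embeddings $a\mapsto a\otimes\mathbf 1$). Let $T_{out}$ be the shift of $\mathcal B^{\mathbb Z}$ that moves site $n$ to site $n+1$. Let $B(A^{\mathbb Z},\Sigma_c)$ be the $C^*$-algebra of bounded complex functions on $A^{\mathbb Z}$ that are measurable for the $\sigma$-algebra $\Sigma_c$ generated by the cylinder sets, with the supremum norm. Put $(T_{in}x)_n=x_{n+1}$ for $x\in A^{\mathbb Z}$ and $T_{in}f=f\circ T_{in}$ for $f\in B(A^{\mathbb Z},\Sigma_c)$. For a probability measure $p$ on $(A^{\mathbb Z},\Sigma_c)$ write $p(f)=\int f\,dp$; $p$ is stationary if it is $T_{in}$-invariant. A cq-channel is a map $W:A^{\mathbb Z}\times\mathcal B^{\mathbb Z}\to\mathbb C$ such that $W(\cdot,b)$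 is measurable for every $b$ and $W(x,\cdot)$ is a state for every $x$. It is stationary if $W(T_{in}x,b)=W(x,T_{out}b)$ for all $x,b$. The associated completely positive unital maps are $K:\mathcal B^{\mathbb Z}\to B(A^{\mathbb Z},\Sigma_c)$, $(K(b))(x)=W(x,b)$, and the map $E:B(A^{\mathbb Z},\Sigma_c)\otimes\mathcal B^{\mathbb Z}\to B(A^{\mathbb Z},\Sigma_c)$ ($C^*$-tensor product) determined by $E(f\otimes b)=f\,K(b)$. The joint input-output state for a probability measure $p$ on $(A^{\mathbb Z},\Sigma_c)$ is $\psi_{p,W}=p\circ E$, so that $\psi_{p,W}(f\otimes b)=\int f(x)W(x,b)\,p(dx)$. A state $\psi$ on $B(A^{\mathbb Z},\Sigma_c)\otimes\mathcal B^{\mathbb Z}$ is stationary if $\psi\circ(T_{in}\otimes T_{out})=\psi$, and ergodic if it is an extreme point of the convex set of stationary states. The channel $W$ is ergodic if it is stationary and $\psi_{p,W}$ is ergodic for every stationary ergodic probability measure $p$ on $(A^{\mathbb Z},\Sigma_c)$. Let $\mathcal K$ be the convex set of all completely positive unital maps $K:\mathcal B^{\mathbb Z}\to B(A^{\mathbb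 Z},\Sigma_c)$ with $K\circ T_{out}=T_{in}\circ K$, and let $\mathcal E$ be the convex set of all completely positive unital maps $E:B(A^{\mathbb Z},\Sigma_c)\otimes\mathcal B^{\mathbb Z}\to B(A^{\mathbb Z},\Sigma_c)$ with $E(f\otimes b)=f\,E(\mathbf 1\otimes b)$ for all $f,b$ and $E\circ(T_{in}\otimes T_{out})=T_{in}\circ E$. Stationary cq-channels $W_1,W_2$ are regarded as equal if $\psi_{p,W_1}(f\otimes b)=\psi_{p,W_2}(f\otimes b)$ for all $f\in B(A^{\mathbb Z},\Sigma_c)$, $b\in\mathcal B^{\mathbb Z}$ and all stationary $p$; likewise $K_1,K_2\in\mathcal K$ are regarded as equal if always $p(fK_1(b))=p(fK_2(b))$, and $E_1,E_2\in\mathcal E$ if always $p(E_1(f\otimes b))=p(E_2(f\otimes b))$. An element $v$ of one of these convex sets is extremal if $v=\alpha v_1+(1-\alpha)v_2$ with $v_1,v_2$ in the set and $0<\alpha<1$ implies $v_1=v_2$, all equalities being understood in this sense. Let $W$ be a stationary cq-channel with associated maps $K$ and $E$. Then the following are equivalent: 1. $W$ is ergodic. 2. $W$ is extremal in the convex set of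 stationary cq-channels. 3. $K$ is extremal in $\mathcal K$. 4. $E$ is extremal in $\mathcal E$. -/

import Mathlib

open scoped ComplexOrder

noncomputable section

namespace CQ

section Quasilocal

open scoped Matrix.Norms.L2Operator Kronecker
open UniformSpace (Completion)

/-- `B^Λ = ⨂_{n ∈ Λ} L(ℂ^d) = L((ℂ^d)^{⊗Λ})`, in the tensor product basis `Λ → Fin d`; it carries
the operator norm and the conjugate transpose as adjoint. -/
abbrev LocalAlg (d : ℕ) (Λ : Finset ℤ) : Type := Matrix (Λ → Fin d) (Λ → Fin d) ℂ

/-- Splitting the coordinates in `Λ'` into those in `Λ` and those in `Λ' \ Λ`. -/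
def splitEquiv (d : ℕ) {Λ Λ' : Finset ℤ} (h : Λ ≤ Λ') :
    (Λ' → Fin d) ≃ (Λ → Fin d) × ((Λ' \ Λ : Finset ℤ) → Fin d) where
  toFun x := (fun n => x ⟨n, h n.2⟩, fun n => x ⟨n, (Finset.mem_sdiff.1 n.2).1⟩)
  invFun z n := if hn : (n : ℤ) ∈ Λ then z.1 ⟨n, hn⟩ else z.2 ⟨n, Finset.mem_sdiff.2 ⟨n.2, hn⟩⟩
  left_inv x := by
    funext n
    by_cases hn : (n : ℤ) ∈ Λ <;> simp [hn]
  right_inv z := by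
    ext n
    · simp
    · have := (Finset.mem_sdiff.1 n.2).2
      simp [this]

/-- The embedding `B^Λ → B^Λ'`, `a ↦ a ⊗ 1`, for `Λ ⊆ Λ'`. -/
def embed (d : ℕ) {Λ Λ' : Finset ℤ} (h : Λ ≤ Λ') : LocalAlg d Λ →⋆ₐ[ℂ] LocalAlg d Λ' where
  toFun M := (M ⊗ₖ (1 : LocalAlg d (Λ' \ Λ))).submatrix (splitEquiv d h) (splitEquiv d h)
  map_one' := by simp
  map_mul' M N := by
    rw [Matrix.submatrix_mul_equiv, ← Matrix.mul_kronecker_mul, mul_one]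
  map_zero' := by simp
  map_add' M N := by rw [Matrix.add_kronecker]; rfl
  commutes' r := by
    rw [Algebra.algebraMap_eq_smul_one, Matrix.smul_kronecker, Matrix.one_kronecker_one,
      Algebra.algebraMap_eq_smul_one]
    exact congrArg (fun M : LocalAlg d Λ' => r • M) (Matrix.submatrix_one_equiv (splitEquiv d h))
  map_star' M := by
    rw [Matrix.star_eq_conjTranspose, Matrix.star_eq_conjTranspose,
      Matrix.conjTranspose_submatrix, Matrix.conjTranspose_kronecker, Matrix.conjTranspose_one]

theorem embed_apply (d : ℕ) {Λ Λ' : Finset ℤ} (h : Λ ≤ Λ') (M : LocalAlg d Λ) (x y : Λ' → Fin d) :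
    embed d h M x y = M (fun n => x ⟨n, h n.2⟩) (fun n => y ⟨n, h n.2⟩) *
      if ∀ n : Λ', (n : ℤ) ∉ Λ → x n = y n then 1 else 0 := by
  have : ((fun n : (Λ' \ Λ : Finset ℤ) => x ⟨n, (Finset.mem_sdiff.1 n.2).1⟩) =
      fun n : (Λ' \ Λ : Finset ℤ) => y ⟨n, (Finset.mem_sdiff.1 n.2).1⟩) ↔ ∀ n : Λ', (n : ℤ) ∉ Λ → x n = y n := by
    rw [funext_iff]
    exact ⟨fun H n hn => H ⟨n, Finset.mem_sdiff.2 ⟨n.2, hn⟩⟩,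
      fun H n => H ⟨n, (Finset.mem_sdiff.1 n.2).1⟩ (Finset.mem_sdiff.1 n.2).2⟩
  change M _ _ * (1 : LocalAlg d (Λ' \ Λ)) _ _ = _
  rw [Matrix.one_apply]
  congr 1
  simp only [splitEquiv, Equiv.coe_fn_mk, this]

theorem embed_injective (d : ℕ) [NeZero d] {Λ Λ' : Finset ℤ} (h : Λ ≤ Λ') :
    Function.Injective (embed d h) := by
  rw [injective_iff_map_eq_zero]
  intro M hM
  ext x y
  have := congrFun (congrFun hM ((splitEquiv d h).symm (x, 0))) ((splitEquiv d h).symm (y, 0))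
  change (M ⊗ₖ (1 : LocalAlg d (Λ' \ Λ))) _ _ = 0 at this
  rw [Equiv.apply_symm_apply, Equiv.apply_symm_apply, Matrix.kroneckerMap_apply] at this
  simpa using this

instance (d : ℕ) : DirectedSystem (LocalAlg d) (fun _ _ h => embed d h) where
  map_self Λ M := by
    ext x y
    rw [embed_apply]
    simp
  map_map Λ₃ Λ₂ Λ₁ h₁ h₂ M := by
    ext x y
    rw [embed_apply, embed_apply, embed_apply, mul_assoc]
    congr 1
    by_cases H : ∀ n : Λ₃, (n : ℤ) ∉ Λ₁ → x n = y n
    · have H1 : ∀ n : Λ₃, (n : ℤ) ∉ Λ₂ → x n = y n := fun n hn => H n fun h => hn (h₁ h)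
      have H2 : ∀ n : Λ₂, (n : ℤ) ∉ Λ₁ → x ⟨n, h₂ n.2⟩ = y ⟨n, h₂ n.2⟩ := fun n hn => H _ hn
      rw [if_pos H, if_pos H1, if_pos H2, mul_one]
    · rw [if_neg H]
      by_cases H1 : ∀ n : Λ₃, (n : ℤ) ∉ Λ₂ → x n = y n
      · rw [if_neg, zero_mul]
        intro H2
        exact H fun n hn => by
          by_cases hn2 : (n : ℤ) ∈ Λ₂
          · exact H2 ⟨n, hn2⟩ hn
          · exact H1 n hn2
      · rw [if_neg H1, mul_zero]

/-- The local observables `B^loc = ⋃_Λ B^Λ`, as the direct limit along `a ↦ a ⊗ 1`. -/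
abbrev LocalObs (d : ℕ) : Type :=
  DirectLimit (LocalAlg d) (fun _ _ h => embed d h)


/-- The canonical map `B^Λ → B^loc`. -/
def toLocal (d : ℕ) (Λ : Finset ℤ) (M : LocalAlg d Λ) : LocalObs d := ⟦⟨Λ, M⟩⟧

theorem toLocal_embed (d : ℕ) {Λ Λ' : Finset ℤ} (h : Λ ≤ Λ') (M : LocalAlg d Λ) :
    toLocal d Λ' (embed d h M) = toLocal d Λ M :=
  (DirectLimit.eq_of_le (F := LocalAlg d) (f := fun _ _ h => embed d h) (Sigma.mk Λ M) Λ' h).symm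

/-- The norm of `B^loc`, which is the operator norm on each `B^Λ`. -/
def localNorm (d : ℕ) [NeZero d] : LocalObs d → ℝ :=
  DirectLimit.lift _ (fun _ M => ‖M‖)
    fun _ _ h M => (NonUnitalStarAlgHom.norm_map _ (embed_injective d h) M).symm

instance (d : ℕ) [NeZero d] : NormedRing (LocalObs d) :=
  RingNorm.toNormedRing
    { toFun := localNorm d
      map_zero' := by
        rw [DirectLimit.zero_def (∅ : Finset ℤ)]; exact norm_zero
      add_le' := DirectLimit.induction₂ _ fun Λ M N => by
        rw [DirectLimit.add_def]; exact norm_add_le M N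
      neg' := DirectLimit.induction _ fun Λ M => by
        rw [DirectLimit.neg_def]; exact norm_neg M
      mul_le' := DirectLimit.induction₂ _ fun Λ M N => by
        rw [DirectLimit.mul_def]; exact norm_mul_le M N
      eq_zero_of_map_eq_zero' := DirectLimit.induction _ fun Λ M h => by
        rw [DirectLimit.zero_def Λ, norm_eq_zero.1 (show ‖M‖ = 0 from h)] }

theorem norm_toLocal (d : ℕ) [NeZero d] (Λ : Finset ℤ) (M : LocalAlg d Λ) :
    ‖toLocal d Λ M‖ = ‖M‖ := rfl

instance (d : ℕ) [NeZero d] : NormedAlgebra ℂ (LocalObs d) where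
  norm_smul_le c := DirectLimit.induction _ fun _ M => norm_smul_le c M

instance (d : ℕ) [NeZero d] : CStarRing (LocalObs d) where
  norm_mul_self_le := DirectLimit.induction _ fun Λ M => by
    rw [DirectLimit.star_def, DirectLimit.mul_def]
    exact CStarRing.norm_mul_self_le M

/-- The completion of a normed `*`-algebra with the `C*`-identity. -/
@[reducible]
def completionCStarAlgebra (P : Type*) [NormedRing P] [NormedAlgebra ℂ P] [StarRing P]
    [CStarRing P] [StarModule ℂ P] : CStarAlgebra (Completion P) :=
  have hs : UniformContinuous (star : P → P) := star_isometry.uniformContinuous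
  have hc : Continuous (Completion.map (star : P → P)) := Completion.continuous_map
  { (inferInstance : NormedRing (Completion P)),
    (inferInstance : CompleteSpace (Completion P)),
    (Completion.algebra P ℂ : Algebra ℂ (Completion P)) with
    star := Completion.map star
    star_involutive := fun x => by
      refine Completion.induction_on x (isClosed_eq (hc.comp hc) continuous_id) fun a => ?_
      rw [Completion.map_coe hs, Completion.map_coe hs, star_star]
    star_mul := fun x y => by
      refine Completion.induction_on₂ x y (isClosed_eq (hc.comp continuous_mul)
        ((hc.comp continuous_snd).mul (hc.comp continuous_fst))) fun a b => ?_
      rw [← Completion.coe_mul, Completion.map_coe hs, Completion.map_coe hs,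
        Completion.map_coe hs, star_mul, Completion.coe_mul]
    star_add := fun x y => by
      refine Completion.induction_on₂ x y (isClosed_eq (hc.comp continuous_add)
        ((hc.comp continuous_fst).add (hc.comp continuous_snd))) fun a b => ?_
      rw [← Completion.coe_add, Completion.map_coe hs, Completion.map_coe hs,
        Completion.map_coe hs, star_add, Completion.coe_add]
    norm_mul_self_le := fun x => by
      refine Completion.induction_on x (isClosed_le (continuous_norm.mul continuous_norm)
        (hc.mul continuous_id).norm) fun a => ?_
      change _ ≤ ‖Completion.map star _ * _‖
      rw [Completion.map_coe hs, ← Completion.coe_mul, Completion.norm_coe, Completion.norm_coe]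
      exact CStarRing.norm_mul_self_le a
    norm_smul_le := norm_smul_le
    star_smul := fun c x => by
      refine Completion.induction_on x (isClosed_eq (hc.comp (continuous_const_smul c))
        (hc.const_smul (star c))) fun a => ?_
      rw [← Completion.coe_smul, Completion.map_coe hs, Completion.map_coe hs, star_smul,
        Completion.coe_smul] }

/-- The quasi-local algebra `B^ℤ`: the norm completion of `B^loc`. -/
def QuasiLocal (d : ℕ) [NeZero d] : Type := Completion (LocalObs d)

/-- The `C*`-algebra structure of the completion. -/
def QuasiLocal.cstar (d : ℕ) [NeZero d] : CStarAlgebra (QuasiLocal d) :=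
  completionCStarAlgebra (LocalObs d)

instance (d : ℕ) [NeZero d] : CStarAlgebra (QuasiLocal d) := QuasiLocal.cstar d

/-- The canonical map `B^Λ → B^ℤ`. -/
def ofLocal (d : ℕ) [NeZero d] (Λ : Finset ℤ) : LocalAlg d Λ →⋆ₐ[ℂ] QuasiLocal d where
  toFun M := ((toLocal d Λ M : LocalObs d) : Completion (LocalObs d))
  map_one' := by
    rw [toLocal, ← DirectLimit.one_def]; exact Completion.coe_one _
  map_mul' M N := by
    rw [toLocal, ← DirectLimit.mul_def]; exact Completion.coe_mul _ _
  map_zero' := by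
    rw [toLocal, ← DirectLimit.zero_def]; exact Completion.coe_zero
  map_add' M N := by
    rw [toLocal, ← DirectLimit.add_def]; exact Completion.coe_add _ _
  commutes' r := congrArg (fun b : LocalObs d => (b : Completion (LocalObs d)))
    (DirectLimit.algebraMap_def (f := fun _ _ h => embed d h) Λ r).symm
  map_star' M := (Completion.map_coe star_isometry.uniformContinuous (toLocal d Λ M)).symm

theorem norm_ofLocal (d : ℕ) [NeZero d] (Λ : Finset ℤ) (M : LocalAlg d Λ) :
    ‖ofLocal d Λ M‖ = ‖M‖ :=
  (Completion.norm_coe (toLocal d Λ M) :)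

theorem ofLocal_embed (d : ℕ) [NeZero d] {Λ Λ' : Finset ℤ} (h : Λ ≤ Λ') (M : LocalAlg d Λ) :
    ofLocal d Λ' (embed d h M) = ofLocal d Λ M :=
  (congrArg (fun b : LocalObs d => (b : Completion (LocalObs d)))
    (toLocal_embed d h M) :)

theorem dense_ofLocal (d : ℕ) [NeZero d] :
    Dense {b : QuasiLocal d | ∃ Λ M, ofLocal d Λ M = b} := by
  refine (Completion.denseRange_coe (α := LocalObs d)).mono ?_
  rintro _ ⟨b, rfl⟩
  obtain ⟨Λ, M, rfl⟩ := DirectLimit.exists_eq_mk _ b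
  exact ⟨Λ, M, rfl⟩

/-- The translate `Λ + 1`. -/
def succSet (Λ : Finset ℤ) : Finset ℤ := Λ.map (Equiv.addRight (1 : ℤ)).toEmbedding

/-- The bijection `Λ → Λ + 1`, `n ↦ n + 1`. -/
def succEquiv (Λ : Finset ℤ) : Λ ≃ succSet Λ :=
  (Equiv.addRight (1 : ℤ)).subtypeEquiv fun a => by simp [succSet]

/-- The copy in `B^(Λ+1)` of an element of `B^Λ`: the tensor factor at the site `n` is moved to
the site `n + 1`. -/
def translate (d : ℕ) (Λ : Finset ℤ) : LocalAlg d Λ →⋆ₐ[ℂ] LocalAlg d (succSet Λ) where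
  toFun M := M.submatrix (fun x n => x (succEquiv Λ n)) (fun y n => y (succEquiv Λ n))
  map_one' := Matrix.submatrix_one_equiv ((succEquiv Λ).arrowCongr (Equiv.refl (Fin d))).symm
  map_mul' M N := (Matrix.submatrix_mul_equiv M N _
    ((succEquiv Λ).arrowCongr (Equiv.refl (Fin d))).symm _).symm
  map_zero' := rfl
  map_add' M N := rfl
  commutes' r := by
    rw [Algebra.algebraMap_eq_smul_one, Algebra.algebraMap_eq_smul_one]
    exact congrArg (fun M : LocalAlg d (succSet Λ) => r • M)
      (Matrix.submatrix_one_equiv ((succEquiv Λ).arrowCongr (Equiv.refl (Fin d))).symm)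
  map_star' M := rfl

theorem translate_injective (d : ℕ) (Λ : Finset ℤ) : Function.Injective (translate d Λ) := by
  intro M N h
  ext x y
  have := congrFun (congrFun h fun n => x ((succEquiv Λ).symm n))
    fun n => y ((succEquiv Λ).symm n)
  change M (fun n => x ((succEquiv Λ).symm (succEquiv Λ n)))
    (fun n => y ((succEquiv Λ).symm (succEquiv Λ n))) =
    N (fun n => x ((succEquiv Λ).symm (succEquiv Λ n)))
    (fun n => y ((succEquiv Λ).symm (succEquiv Λ n))) at this
  simpa only [Equiv.symm_apply_apply] using this

theorem translate_embed (d : ℕ) {Λ Λ' : Finset ℤ} (h : Λ ≤ Λ') (h' : succSet Λ ≤ succSet Λ')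
    (M : LocalAlg d Λ) :
    translate d Λ' (embed d h M) = embed d h' (translate d Λ M) := by
  ext x y
  change embed d h M _ _ = _
  rw [embed_apply, embed_apply]
  congr 1
  refine if_congr ?_ rfl rfl
  rw [← (succEquiv Λ').forall_congr_right]
  refine forall_congr' fun n => ?_
  have : ((succEquiv Λ' n : ℤ) ∈ succSet Λ) ↔ (n : ℤ) ∈ Λ := by
    change (n : ℤ) + 1 ∈ succSet Λ ↔ _
    simp [succSet]
  rw [this]

theorem succSet_mono {Λ Λ' : Finset ℤ} (h : Λ ≤ Λ') : succSet Λ ≤ succSet Λ' :=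
  Finset.map_subset_map.2 h

/-- The shift on `B^loc`. -/
def localShift (d : ℕ) : LocalObs d →⋆ₐ[ℂ] LocalObs d where
  toFun := DirectLimit.lift _ (fun Λ M => toLocal d (succSet Λ) (translate d Λ M))
    fun Λ Λ' h M => by
      rw [translate_embed d h (succSet_mono h)]
      exact (toLocal_embed d (succSet_mono h) _).symm
  map_one' := by
    conv_lhs => rw [DirectLimit.one_def (∅ : Finset ℤ), DirectLimit.lift_def, map_one]
    exact (DirectLimit.one_def (f := fun _ _ h => embed d h) _).symm
  map_mul' := DirectLimit.induction₂ _ fun Λ M N => by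
    rw [DirectLimit.mul_def, DirectLimit.lift_def, DirectLimit.lift_def, DirectLimit.lift_def,
      map_mul]
    exact (DirectLimit.mul_def _ _ _).symm
  map_zero' := by
    conv_lhs => rw [DirectLimit.zero_def (∅ : Finset ℤ), DirectLimit.lift_def, map_zero]
    exact (DirectLimit.zero_def (f := fun _ _ h => embed d h) _).symm
  map_add' := DirectLimit.induction₂ _ fun Λ M N => by
    rw [DirectLimit.add_def, DirectLimit.lift_def, DirectLimit.lift_def, DirectLimit.lift_def,
      map_add]
    exact (DirectLimit.add_def _ _ _).symm
  commutes' r := by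
    conv_lhs =>
      rw [DirectLimit.algebraMap_def (∅ : Finset ℤ), DirectLimit.lift_def, AlgHomClass.commutes]
    exact (DirectLimit.algebraMap_def (f := fun _ _ h => embed d h) _ _).symm
  map_star' := DirectLimit.induction _ fun Λ M => by
    rw [DirectLimit.star_def, DirectLimit.lift_def, DirectLimit.lift_def, map_star]
    rfl

theorem norm_localShift (d : ℕ) [NeZero d] (b : LocalObs d) : ‖localShift d b‖ = ‖b‖ := by
  refine DirectLimit.induction _ (fun Λ M => ?_) b
  exact NonUnitalStarAlgHom.norm_map _ (translate_injective d Λ) M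

theorem isometry_localShift (d : ℕ) [NeZero d] : Isometry (localShift d) :=
  AddMonoidHomClass.isometry_of_norm _ (norm_localShift d)

/-- The shift `T` on `B^ℤ`, the continuous extension of the shift on `B^loc`. -/
def shiftOut (d : ℕ) [NeZero d] : QuasiLocal d →⋆ₐ[ℂ] QuasiLocal d where
  toFun := Completion.map (localShift d)
  map_one' := map_one (Completion.mapRingHom (localShift d : LocalObs d →+* LocalObs d)
    (isometry_localShift d).continuous)
  map_mul' := map_mul (Completion.mapRingHom (localShift d : LocalObs d →+* LocalObs d)
    (isometry_localShift d).continuous)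
  map_zero' := map_zero (Completion.mapRingHom (localShift d : LocalObs d →+* LocalObs d)
    (isometry_localShift d).continuous)
  map_add' := map_add (Completion.mapRingHom (localShift d : LocalObs d →+* LocalObs d)
    (isometry_localShift d).continuous)
  commutes' r := (Completion.map_coe (isometry_localShift d).uniformContinuous _).trans
    (congrArg _ (AlgHomClass.commutes (localShift d) r))
  map_star' b := by
    refine Completion.induction_on (α := LocalObs d) b (isClosed_eq (X := Completion (LocalObs d)) (Y := Completion (LocalObs d))
      (Completion.continuous_map.comp Completion.continuous_map)
      (Completion.continuous_map.comp Completion.continuous_map)) fun a => ?_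
    change Completion.map (localShift d) (Completion.map star _) =
      Completion.map star (Completion.map (localShift d) _)
    rw [Completion.map_coe star_isometry.uniformContinuous,
      Completion.map_coe (isometry_localShift d).uniformContinuous,
      Completion.map_coe (isometry_localShift d).uniformContinuous,
      Completion.map_coe star_isometry.uniformContinuous, map_star]

theorem shiftOut_ofLocal (d : ℕ) [NeZero d] (Λ : Finset ℤ) (M : LocalAlg d Λ) :
    shiftOut d (ofLocal d Λ M) = ofLocal d (succSet Λ) (translate d Λ M) :=
  (Completion.map_coe (isometry_localShift d).uniformContinuous (toLocal d Λ M) :)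

instance (d : ℕ) [NeZero d] : PartialOrder (QuasiLocal d) := CStarAlgebra.spectralOrder _
instance (d : ℕ) [NeZero d] : StarOrderedRing (QuasiLocal d) := CStarAlgebra.spectralOrderedRing _

instance (d : ℕ) [NeZero d] : Nontrivial (QuasiLocal d) :=
  ⟨⟨0, 1, fun h => by
    have := congrArg norm h
    rw [← map_one (ofLocal d ∅), norm_ofLocal, norm_zero, norm_one] at this
    exact zero_ne_one this⟩⟩

end Quasilocal

section Input

open scoped ENNReal

/-- The shift `(T x)_n = x_{n+1}` on doubly infinite sequences. -/
def shiftIn {A : Type*} (x : ℤ → A) : ℤ → A := fun n => x (n + 1)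

/-- The left shift as a bijection. -/
theorem shiftIn_bijective {A : Type*} : Function.Bijective (shiftIn (A := A)) :=
  ⟨fun x y h => funext fun n => by simpa [shiftIn] using congrFun h (n - 1),
    fun y => ⟨fun n => y (n - 1), funext fun n => by simp [shiftIn]⟩⟩

theorem measurable_shiftIn {A : Type*} [MeasurableSpace A] : Measurable (shiftIn (A := A)) :=
  measurable_pi_lambda _ fun n => measurable_pi_apply (n + 1)

/-- The measurable functions, as a `*`-subalgebra of the bounded functions `A^ℤ → ℂ`. -/
def bddMeasSubalgebra (A : Type*) [MeasurableSpace A] :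
    StarSubalgebra ℂ (lp (fun _ : ℤ → A => ℂ) ∞) where
  carrier := {f | Measurable f}
  mul_mem' hf hg := Measurable.mul hf hg
  one_mem' := measurable_const
  add_mem' hf hg := Measurable.add hf hg
  zero_mem' := measurable_const
  algebraMap_mem' _ := measurable_const
  star_mem' hf := Complex.continuous_conj.measurable.comp hf

/-- `B(A^ℤ, Σ_c)`: the bounded measurable functions `A^ℤ → ℂ` with the supremum norm. -/
def BddMeas (A : Type*) [MeasurableSpace A] : Type _ := bddMeasSubalgebra A

theorem lp_tendsto_apply {X E : Type*} [NormedAddCommGroup E] {f : ℕ → lp (fun _ : X => E) ∞}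
    {g : lp (fun _ : X => E) ∞} (h : Filter.Tendsto f Filter.atTop (nhds g)) (x : X) :
    Filter.Tendsto (fun n => f n x) Filter.atTop (nhds (g x)) := by
  rw [tendsto_iff_norm_sub_tendsto_zero] at h ⊢
  exact squeeze_zero (fun _ => norm_nonneg _)
    (fun n => lp.norm_apply_le_norm ENNReal.top_ne_zero (f n - g) x) h

theorem isClosed_bddMeasSubalgebra (A : Type*) [MeasurableSpace A] :
    IsClosed (bddMeasSubalgebra A : Set (lp (fun _ : ℤ → A => ℂ) ∞)) := by
  refine isClosed_of_closure_subset fun g hg => ?_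
  obtain ⟨f, hf, hfg⟩ := mem_closure_iff_seq_limit.1 hg
  exact measurable_of_tendsto_metrizable (f := fun n => (f n : (ℤ → A) → ℂ)) hf
    (tendsto_pi_nhds.2 fun x => lp_tendsto_apply hfg x)

namespace BddMeas

variable {A : Type*} [MeasurableSpace A]

/-- The `C*`-algebra structure inherited from the bounded functions. -/
def cstar (A : Type*) [MeasurableSpace A] : CStarAlgebra (BddMeas A) :=
  StarSubalgebra.cstarAlgebra (bddMeasSubalgebra A)
    (h_closed := isClosed_bddMeasSubalgebra A)

instance : CStarAlgebra (BddMeas A) := cstar A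

instance : PartialOrder (BddMeas A) := CStarAlgebra.spectralOrder _
instance : StarOrderedRing (BddMeas A) := CStarAlgebra.spectralOrderedRing _

instance : CoeFun (BddMeas A) fun _ => (ℤ → A) → ℂ := ⟨fun f => f.1⟩

theorem measurable (f : BddMeas A) : Measurable (f : (ℤ → A) → ℂ) := f.2

theorem norm_apply_le (f : BddMeas A) (x : ℤ → A) : ‖f x‖ ≤ ‖f‖ :=
  lp.norm_apply_le_norm ENNReal.top_ne_zero f.1 x

theorem ext {f g : BddMeas A} (h : ∀ x, f x = g x) : f = g :=
  Subtype.ext (lp.ext (funext h))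

theorem mul_comm (f g : BddMeas A) : f * g = g * f := ext fun x => _root_.mul_comm (f x) (g x)

/-- A bounded measurable function as an element of `B(A^ℤ, Σ_c)`. -/
def mk (f : (ℤ → A) → ℂ) (hf : Measurable f) (C : ℝ) (hC : ∀ x, ‖f x‖ ≤ C) : BddMeas A :=
  ⟨⟨f, memℓp_infty ⟨C, by rintro _ ⟨x, rfl⟩; exact hC x⟩⟩, hf⟩

/-- The shift `f ↦ f ∘ T` on `B(A^ℤ, Σ_c)`. -/
def shift (f : BddMeas A) : BddMeas A :=
  mk (fun x => f (shiftIn x)) (f.measurable.comp measurable_shiftIn) ‖f‖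
    fun x => f.norm_apply_le (shiftIn x)

/-- The expectation functional `f ↦ ∫ f dp` of a probability measure `p` on `A^ℤ`. -/
def expect (p : MeasureTheory.Measure (ℤ → A)) [MeasureTheory.IsProbabilityMeasure p] :
    BddMeas A →ₗ[ℂ] ℂ :=
  have hi (f : BddMeas A) : MeasureTheory.Integrable (f : (ℤ → A) → ℂ) p :=
    MeasureTheory.Integrable.of_bound f.measurable.aestronglyMeasurable ‖f‖
      (Filter.Eventually.of_forall f.norm_apply_le)
  { toFun := fun f => ∫ x, f x ∂p
    map_add' := fun f g => MeasureTheory.integral_add (hi f) (hi g)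
    map_smul' := fun c _ => MeasureTheory.integral_const_mul c _ }

end BddMeas

end Input

section Tensor

open scoped ENNReal TensorProduct

variable (A : Type*) [MeasurableSpace A] (B : Type*) [CStarAlgebra B] [Nontrivial B]

/-- The bounded functions `A^ℤ → B` with the supremum norm. -/
abbrev BddFun : Type _ := lp (fun _ : ℤ → A => B) ∞

instance : CStarAlgebra (BddFun A B) where

/-- `f ↦ (x ↦ f(x) 1)`. -/
def inclLeft : BddMeas A →⋆ₐ[ℂ] BddFun A B where
  toFun f := ⟨fun x => algebraMap ℂ (B) (f x), memℓp_infty ⟨‖f‖, by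
    rintro _ ⟨x, rfl⟩
    simpa using f.norm_apply_le x⟩⟩
  map_one' := lp.ext <| funext fun x => map_one (algebraMap ℂ (B))
  map_mul' f g := lp.ext <| funext fun x => map_mul (algebraMap ℂ (B)) _ _
  map_zero' := lp.ext <| funext fun x => map_zero (algebraMap ℂ (B))
  map_add' f g := lp.ext <| funext fun x => map_add (algebraMap ℂ (B)) _ _
  commutes' r := rfl
  map_star' f := lp.ext <| funext fun x => algebraMap_star_comm (A := B) (f x)

/-- `b ↦ (x ↦ b)`. -/
def inclRight : B →⋆ₐ[ℂ] BddFun A B where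
  toFun b := ⟨fun _ => b, memℓp_infty ⟨‖b‖, by rintro _ ⟨x, rfl⟩; exact le_rfl⟩⟩
  map_one' := rfl
  map_mul' _ _ := rfl
  map_zero' := rfl
  map_add' _ _ := rfl
  commutes' _ := rfl
  map_star' _ := rfl

/-- Evaluation at `x`. -/
def evalAt (x : ℤ → A) : BddFun A B →⋆ₐ[ℂ] B where
  toFun t := t x
  map_one' := rfl
  map_mul' _ _ := rfl
  map_zero' := rfl
  map_add' _ _ := rfl
  commutes' _ := rfl
  map_star' _ := rfl

/-- The representation of the algebraic tensor product `B(A^ℤ, Σ_c) ⊗ B` by functions `A^ℤ → B`,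
`f ⊗ b ↦ (x ↦ f(x) b)`. -/
def algTensor : BddMeas A ⊗[ℂ] B →ₐ[ℂ] BddFun A B :=
  Algebra.TensorProduct.lift (inclLeft A B : BddMeas A →ₐ[ℂ] BddFun A B)
    (inclRight A B : B →ₐ[ℂ] BddFun A B)
    fun f b => lp.ext <| funext fun x => Algebra.commutes (f x) b

theorem algTensor_tmul_apply (f : BddMeas A) (b : B) (x : ℤ → A) :
    algTensor A B (f ⊗ₜ b) x = f x • b := by
  rw [Algebra.smul_def]
  rfl

theorem algTensor_injective : Function.Injective (algTensor A B) := by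
  rw [injective_iff_map_eq_zero]
  intro t ht
  let e := Module.Basis.ofVectorSpace ℂ B
  obtain ⟨c, rfl⟩ := TensorProduct.eq_repr_basis_right e t
  have hc : ∀ i ∈ c.support, c i = 0 := by
    intro i hi
    refine BddMeas.ext fun x => ?_
    refine linearIndependent_iff'.1 e.linearIndependent c.support (fun j => c j x) ?_ i hi
    have hx := congrArg (evalAt A B x) ht
    rw [Finsupp.sum, map_sum, map_sum, map_zero] at hx
    rw [← hx]
    exact Finset.sum_congr rfl fun j _ => (algTensor_tmul_apply A B (c j) (e j) x).symm
  refine Finset.sum_eq_zero fun i hi => ?_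
  rw [hc i hi]
  exact TensorProduct.zero_tmul _ _

theorem star_algTensor_tmul (f : BddMeas A) (b : B) :
    star (algTensor A B (f ⊗ₜ b)) = algTensor A B (star f ⊗ₜ star b) := by
  refine lp.ext <| funext fun x => ?_
  rw [algTensor_tmul_apply, lp.star_apply, algTensor_tmul_apply, star_smul]
  rfl

/-- The image of the algebraic tensor product, a `*`-algebra. -/
def algJoint : StarSubalgebra ℂ (BddFun A B) where
  __ := (algTensor A B).range
  star_mem' := by
    rintro _ ⟨t, rfl⟩
    change star (algTensor A B t) ∈ (algTensor A B).range
    induction t using TensorProduct.induction_on with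
    | zero => rw [map_zero, star_zero]; exact zero_mem _
    | add s t hs ht => rw [map_add, star_add]; exact add_mem hs ht
    | tmul f b => rw [star_algTensor_tmul]; exact ⟨_, rfl⟩

/-- The `C*`-tensor product `B(A^ℤ, Σ_c) ⊗ B`: the completion of the algebraic tensor product for
the `C*`-norm `‖∑ fᵢ ⊗ bᵢ‖ = sup_x ‖∑ fᵢ(x) bᵢ‖`, realised as a closed `*`-algebra of functions
`A^ℤ → B`. As the first factor is abelian, this is the only `C*`-norm. -/
def Joint : Type _ := (algJoint A B).topologicalClosure

namespace Joint

variable {A B}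

/-- The `C*`-algebra structure inherited from the bounded functions. -/
def cstar (A : Type*) [MeasurableSpace A] (B : Type*) [CStarAlgebra B] [Nontrivial B] :
    CStarAlgebra (Joint A B) :=
  StarSubalgebra.cstarAlgebra (algJoint A B).topologicalClosure
    (h_closed := (algJoint A B).isClosed_topologicalClosure)

instance : CStarAlgebra (Joint A B) := cstar A B

instance : PartialOrder (Joint A B) := CStarAlgebra.spectralOrder _
instance : StarOrderedRing (Joint A B) := CStarAlgebra.spectralOrderedRing _

instance : CoeFun (Joint A B) fun _ => (ℤ → A) → B := ⟨fun t => t.1⟩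

theorem ext {s t : Joint A B} (h : ∀ x, s x = t x) : s = t :=
  Subtype.ext (lp.ext (funext h))

theorem norm_apply_le (t : Joint A B) (x : ℤ → A) : ‖t x‖ ≤ ‖t‖ :=
  lp.norm_apply_le_norm ENNReal.top_ne_zero t.1 x

/-- The elementary tensor `f ⊗ b`. -/
def tmul (f : BddMeas A) (b : B) : Joint A B :=
  ⟨algTensor A B (f ⊗ₜ b), (algJoint A B).le_topologicalClosure ⟨_, rfl⟩⟩

theorem tmul_apply (f : BddMeas A) (b : B) (x : ℤ → A) : tmul f b x = f x • b :=
  algTensor_tmul_apply A B f b x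

/-- A closed property which is additive and holds for elementary tensors holds for all elements. -/
theorem induction {P : Joint A B → Prop} (hP : IsClosed {t | P t})
    (htmul : ∀ f b, P (tmul f b)) (hadd : ∀ s t, P s → P t → P (s + t)) (t : Joint A B) : P t := by
  have h0 (u : BddMeas A ⊗[ℂ] B) (hu : algTensor A B u ∈ (algJoint A B).topologicalClosure) :
      P ⟨algTensor A B u, hu⟩ := by
    induction u using TensorProduct.induction_on with
    | zero =>
      have h : (⟨algTensor A B 0, hu⟩ : Joint A B) = tmul 0 0 :=
        Subtype.ext (congrArg (algTensor A B) (TensorProduct.zero_tmul _ _).symm :)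
      rw [h]
      exact htmul 0 0
    | add u v ihu ihv =>
      have hu' := (algJoint A B).le_topologicalClosure ⟨u, rfl⟩
      have hv' := (algJoint A B).le_topologicalClosure ⟨v, rfl⟩
      have h : (⟨algTensor A B (u + v), hu⟩ : Joint A B) =
          (⟨algTensor A B u, hu'⟩ : Joint A B) + (⟨algTensor A B v, hv'⟩ : Joint A B) :=
        Subtype.ext (map_add (algTensor A B) u v :)
      rw [h]
      exact hadd _ _ (ihu hu') (ihv hv')
    | tmul f b => exact htmul f b
  obtain ⟨s, hs⟩ := t
  obtain ⟨u, hu, hus⟩ := mem_closure_iff_seq_limit.1 hs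
  refine hP.mem_of_tendsto (b := Filter.atTop)
    (f := fun n => (⟨u n, (algJoint A B).le_topologicalClosure (hu n)⟩ : Joint A B))
    (tendsto_subtype_rng.2 hus) (Filter.Eventually.of_forall fun n => ?_)
  obtain ⟨v, hv⟩ := hu n
  have : u n = algTensor A B v := hv.symm
  simp only [this]
  exact h0 v _

/-- Pointwise application of a `*`-homomorphism `T` after the shift: `t ↦ (x ↦ T (t (T_in x)))`. -/
def shiftFun (T : B →⋆ₐ[ℂ] B) : BddFun A B →⋆ₐ[ℂ] BddFun A B where
  toFun t := ⟨fun x => T (t (shiftIn x)), memℓp_infty ⟨‖t‖, by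
    rintro _ ⟨x, rfl⟩
    exact (NonUnitalStarAlgHom.norm_apply_le T _).trans
      (lp.norm_apply_le_norm ENNReal.top_ne_zero t _)⟩⟩
  map_one' := lp.ext <| funext fun _ => map_one T
  map_mul' _ _ := lp.ext <| funext fun _ => map_mul T _ _
  map_zero' := lp.ext <| funext fun _ => map_zero T
  map_add' _ _ := lp.ext <| funext fun _ => map_add T _ _
  commutes' r := lp.ext <| funext fun _ => AlgHomClass.commutes T r
  map_star' _ := lp.ext <| funext fun _ => map_star T _

theorem shiftFun_mem (T : B →⋆ₐ[ℂ] B) (t : Joint A B) :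
    shiftFun T t.1 ∈ (algJoint A B).topologicalClosure := by
  have hT : Continuous (shiftFun (A := A) T) :=
    AddMonoidHomClass.continuous_of_bound _ 1 fun t => by
      rw [one_mul]; exact NonUnitalStarAlgHom.norm_apply_le _ t
  refine induction (P := fun t => shiftFun T t.1 ∈ (algJoint A B).topologicalClosure)
    ((algJoint A B).isClosed_topologicalClosure.preimage (hT.comp continuous_subtype_val))
    (fun f b => ?_) (fun s t hs ht => ?_) t
  · refine (algJoint A B).le_topologicalClosure ⟨f.shift ⊗ₜ T b, lp.ext <| funext fun x => ?_⟩
    exact (algTensor_tmul_apply A B f.shift (T b) x).trans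
      ((map_smul T _ _).symm.trans (congrArg T (tmul_apply f b (shiftIn x)).symm))
  · change shiftFun T (s.1 + t.1) ∈ _
    rw [map_add]
    exact add_mem hs ht

/-- `T_in ⊗ T` on `B(A^ℤ, Σ_c) ⊗ B`, that is `f ⊗ b ↦ (f ∘ T_in) ⊗ T b`. -/
def shift (T : B →⋆ₐ[ℂ] B) (t : Joint A B) : Joint A B := ⟨shiftFun T t.1, shiftFun_mem T t⟩

theorem shift_tmul (T : B →⋆ₐ[ℂ] B) (f : BddMeas A) (b : B) :
    shift T (tmul f b) = tmul f.shift (T b) := by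
  refine ext fun x => ?_
  rw [tmul_apply]
  exact (congrArg T (tmul_apply f b (shiftIn x))).trans (map_smul T _ _)

end Joint

end Tensor

section Channels

open MeasureTheory

/-- States of a unital `C*`-algebra: normalised positive linear functionals. -/
def IsState {B : Type*} [CStarAlgebra B] (ψ : B →ₗ[ℂ] ℂ) : Prop :=
  (∀ b, 0 ≤ ψ (star b * b)) ∧ ψ 1 = 1

theorem IsState.norm_le {B : Type*} [CStarAlgebra B] {ψ : B →ₗ[ℂ] ℂ} (h : IsState ψ) (b : B) :
    ‖ψ b‖ ≤ 4 * ‖b‖ := by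
  let _ := CStarAlgebra.spectralOrder B
  let _ := CStarAlgebra.spectralOrderedRing B
  let φ : B →ₚ[ℂ] ℂ := PositiveLinearMap.mk₀ ψ fun x hx => by
    obtain ⟨s, rfl⟩ := CStarAlgebra.nonneg_iff_eq_star_mul_self.1 hx
    exact h.1 s
  have hφ (x : B) (hx : 0 ≤ x) : ‖ψ x‖ ≤ ‖x‖ := by
    have := φ.norm_apply_le_of_nonneg x hx
    rwa [show φ 1 = 1 from h.2, norm_one, one_mul] at this
  obtain ⟨y, hy, hyn, hb⟩ := CStarAlgebra.exists_sum_four_nonneg b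
  rw [congrArg ψ hb, map_sum]
  refine (norm_sum_le _ _).trans ((Finset.sum_le_sum (g := fun _ => ‖b‖) fun i _ => ?_).trans ?_)
  · rw [map_smul, norm_smul, norm_pow, Complex.norm_I, one_pow, one_mul]
    exact (hφ _ (hy i)).trans (hyn i)
  · simp

/-- A cq-channel with input `A^ℤ` and output algebra `B`: a map `W : A^ℤ × B → ℂ` such that
`W(·, b)` is measurable for each `b` and `W(x, ·)` is a state for each `x`. -/
structure CQChannel (A : Type*) [MeasurableSpace A] (B : Type*) [CStarAlgebra B] where
  /-- The state `W(x, ·)`. -/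
  toFun : (ℤ → A) → B →ₗ[ℂ] ℂ
  measurable : ∀ b, Measurable fun x => toFun x b
  isState : ∀ x, IsState (toFun x)

variable {A : Type*} [MeasurableSpace A] {B : Type*} [CStarAlgebra B]

namespace CQChannel

/-- The map `K : B → B(A^ℤ, Σ_c)`, `(K b)(x) = W(x, b)`, of a cq-channel. -/
def mapK (W : CQChannel A B) : B →ₗ[ℂ] BddMeas A where
  toFun b := BddMeas.mk (fun x => W.toFun x b) (W.measurable b) (4 * ‖b‖)
    fun x => (W.isState x).norm_le b
  map_add' b c := BddMeas.ext fun x => map_add (W.toFun x) b c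
  map_smul' r b := BddMeas.ext fun x => map_smul (W.toFun x) r b

theorem mapK_apply (W : CQChannel A B) (b : B) (x : ℤ → A) : W.mapK b x = W.toFun x b := rfl

variable [Nontrivial B]

theorem measurable_apply (W : CQChannel A B) (t : Joint A B) :
    Measurable fun x => W.toFun x (t x) := by
  refine Joint.induction (P := fun t => Measurable fun x => W.toFun x (t x))
    (isClosed_of_closure_subset fun t ht => ?_) (fun f b => ?_)
    (fun s t hs ht => ?_) t
  · obtain ⟨u, hu, hut⟩ := mem_closure_iff_seq_limit.1 ht
    refine measurable_of_tendsto_metrizable (f := fun n x => W.toFun x (u n x)) hu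
      (tendsto_pi_nhds.2 fun x => ?_)
    rw [tendsto_iff_norm_sub_tendsto_zero] at hut ⊢
    refine squeeze_zero (fun _ => norm_nonneg _) (fun n => ?_)
      (by simpa using hut.const_mul (4 : ℝ))
    rw [← map_sub]
    exact ((W.isState x).norm_le _).trans
      (mul_le_mul_of_nonneg_left ((u n - t).norm_apply_le x) (by norm_num))
  · simp only [Joint.tmul_apply, map_smul, smul_eq_mul]
    exact f.measurable.mul (W.measurable b)
  · have h : (fun x => W.toFun x ((s + t) x)) = fun x => W.toFun x (s x) + W.toFun x (t x) :=
      funext fun x => map_add (W.toFun x) (s x) (t x)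
    rw [h]
    exact Measurable.add hs ht

/-- The map `E : B(A^ℤ, Σ_c) ⊗ B → B(A^ℤ, Σ_c)` of a cq-channel: the continuous linear map with
`E(f ⊗ b) = f K(b)`, which is `E(t)(x) = W(x, t(x))`. -/
def mapE (W : CQChannel A B) : Joint A B →ₗ[ℂ] BddMeas A where
  toFun t := BddMeas.mk (fun x => W.toFun x (t x)) (W.measurable_apply t) (4 * ‖t‖)
    fun x => ((W.isState x).norm_le _).trans
      (mul_le_mul_of_nonneg_left (t.norm_apply_le x) (by norm_num))
  map_add' s t := BddMeas.ext fun x => map_add (W.toFun x) (s x) (t x)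
  map_smul' r t := BddMeas.ext fun x => map_smul (W.toFun x) r (t x)

theorem mapE_tmul (W : CQChannel A B) (f : BddMeas A) (b : B) :
    W.mapE (Joint.tmul f b) = f * W.mapK b := by
  refine BddMeas.ext fun x => ?_
  change W.toFun x (Joint.tmul f b x) = f x * W.toFun x b
  rw [Joint.tmul_apply, map_smul, smul_eq_mul]

/-- The joint input-output state `ψ_{p,W} = p ∘ E` on `B(A^ℤ, Σ_c) ⊗ B`. -/
def jointState (W : CQChannel A B) (p : Measure (ℤ → A)) [IsProbabilityMeasure p] :
    Joint A B →ₗ[ℂ] ℂ :=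
  BddMeas.expect p ∘ₗ W.mapE

theorem jointState_tmul (W : CQChannel A B) (p : Measure (ℤ → A)) [IsProbabilityMeasure p]
    (f : BddMeas A) (b : B) :
    W.jointState p (Joint.tmul f b) = ∫ x, f x * W.toFun x b ∂p := by
  change BddMeas.expect p (W.mapE (Joint.tmul f b)) = _
  rw [mapE_tmul]
  rfl

end CQChannel

section Ergodicity

/-- The stationary states of a `C*`-algebra with shift `S`. -/
def stationaryStates {𝔄 : Type*} [CStarAlgebra 𝔄] (S : 𝔄 → 𝔄) : Set (𝔄 →ₗ[ℂ] ℂ) :=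
  {ψ | IsState ψ ∧ ∀ a, ψ (S a) = ψ a}

/-- Ergodic states: the extreme points of the convex set of stationary states. -/
def IsErgodicState {𝔄 : Type*} [CStarAlgebra 𝔄] (S : 𝔄 → 𝔄) (ψ : 𝔄 →ₗ[ℂ] ℂ) : Prop :=
  ψ ∈ Set.extremePoints ℝ (stationaryStates S)

/-- `W` is stationary: `W(T_in x, b) = W(x, T b)`. -/
def CQChannel.IsStationary (T : B →⋆ₐ[ℂ] B) (W : CQChannel A B) : Prop :=
  ∀ x b, W.toFun (shiftIn x) b = W.toFun x (T b)

/-- `W` is ergodic: it is stationary and the joint input-output state is ergodic for every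
stationary ergodic input probability measure. -/
def CQChannel.IsErgodic [Nontrivial B] (T : B →⋆ₐ[ℂ] B) (W : CQChannel A B) : Prop :=
  W.IsStationary T ∧ ∀ (p : Measure (ℤ → A)) [IsProbabilityMeasure p],
    Ergodic shiftIn p → IsErgodicState (Joint.shift T) (W.jointState p)

/-- `v` is extremal in `S`, where elements are identified according to `eqv`: `v ∈ S`, and whenever
`v` equals `a v₁ + (1 - a) v₂` with `v₁, v₂ ∈ S` and `0 < a < 1`, then `v₁` equals `v₂`. -/
def IsExtremalIn {V : Type*} [AddCommMonoid V] [Module ℝ V] (eqv : V → V → Prop) (S : Set V)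
    (v : V) : Prop :=
  v ∈ S ∧ ∀ v₁ ∈ S, ∀ v₂ ∈ S, ∀ a ∈ Set.Ioo (0 : ℝ) 1,
    eqv v (a • v₁ + (1 - a) • v₂) → eqv v₁ v₂

/-- Equality of channels: `∫ f(x) W₁(x, b) p(dx) = ∫ f(x) W₂(x, b) p(dx)` for all `f`, `b` and all
stationary `p`; these integrals are the values `ψ_{p,W}(f ⊗ b)` of the joint states. -/
def ChannelEq (w₁ w₂ : (ℤ → A) → B →ₗ[ℂ] ℂ) : Prop :=
  ∀ (p : Measure (ℤ → A)) [IsProbabilityMeasure p], MeasurePreserving shiftIn p p →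
    ∀ (f : BddMeas A) (b : B), ∫ x, f x * w₁ x b ∂p = ∫ x, f x * w₂ x b ∂p

/-- Equality of maps `K`: `p(f K₁(b)) = p(f K₂(b))` for all `f`, `b` and all stationary `p`. -/
def MapKEq (K₁ K₂ : B →ₗ[ℂ] BddMeas A) : Prop :=
  ∀ (p : Measure (ℤ → A)) [IsProbabilityMeasure p], MeasurePreserving shiftIn p p →
    ∀ (f : BddMeas A) (b : B), BddMeas.expect p (f * K₁ b) = BddMeas.expect p (f * K₂ b)

/-- Equality of maps `E`: `p(E₁(f ⊗ b)) = p(E₂(f ⊗ b))` for all `f`, `b` and all stationary `p`. -/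
def MapEEq [Nontrivial B] (E₁ E₂ : Joint A B →ₗ[ℂ] BddMeas A) : Prop :=
  ∀ (p : Measure (ℤ → A)) [IsProbabilityMeasure p], MeasurePreserving shiftIn p p →
    ∀ (f : BddMeas A) (b : B),
      BddMeas.expect p (E₁ (Joint.tmul f b)) = BddMeas.expect p (E₂ (Joint.tmul f b))

/-- The set of stationary cq-channels. -/
def stationaryChannels (A : Type*) [MeasurableSpace A] (T : B →⋆ₐ[ℂ] B) :
    Set ((ℤ → A) → B →ₗ[ℂ] ℂ) :=
  {w | ∃ W : CQChannel A B, W.IsStationary T ∧ W.toFun = w}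

/-- Completely positive linear maps. -/
def IsCP {𝔄 𝔅 : Type*} [CStarAlgebra 𝔄] [PartialOrder 𝔄] [StarOrderedRing 𝔄]
    [CStarAlgebra 𝔅] [PartialOrder 𝔅] [StarOrderedRing 𝔅] (φ : 𝔄 →ₗ[ℂ] 𝔅) : Prop :=
  ∃ Φ : CompletelyPositiveMap 𝔄 𝔅, Φ.toLinearMap = φ

/-- The completely positive unital maps `K : B → B(A^ℤ, Σ_c)` with `K ∘ T = T_in ∘ K`. -/
def setK (A : Type*) [MeasurableSpace A] [PartialOrder B] [StarOrderedRing B]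
    (T : B →⋆ₐ[ℂ] B) : Set (B →ₗ[ℂ] BddMeas A) :=
  {K | IsCP K ∧ K 1 = 1 ∧ ∀ b, K (T b) = (K b).shift}

/-- The completely positive unital maps `E : B(A^ℤ, Σ_c) ⊗ B → B(A^ℤ, Σ_c)` with
`E(f ⊗ b) = f E(1 ⊗ b)` and `E ∘ (T_in ⊗ T) = T_in ∘ E`. -/
def setE (A : Type*) [MeasurableSpace A] [Nontrivial B] (T : B →⋆ₐ[ℂ] B) :
    Set (Joint A B →ₗ[ℂ] BddMeas A) :=
  {E | IsCP E ∧ E 1 = 1 ∧ (∀ f b, E (Joint.tmul f b) = f * E (Joint.tmul 1 b)) ∧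
    ∀ t, E (Joint.shift T t) = (E t).shift}

end Ergodicity

end Channels

end CQ

end

open scoped ComplexOrder

noncomputable section

namespace CQ


/-! ### Complete positivity of maps into function algebras. -/

section CompletePositivity

/-! The equivalence of 2, 3 and 4 is a change of description. `W` and `K` are the same function of
two variables, and complete positivity is automatic because the target is commutative
(`isCP_of_pointwise`). The module identity makes `E` determined by `E(1 ⊗ ·)`. These passages are
affine and respect the three notions of equality.

1 → 2: let `W` equal `a W₁ + (1 - a) W₂`. For ergodic `q` the joint state of `W` is extreme, so
those of `W₁` and `W₂` coincide, and `K₁ b = K₂ b` holds `q`-almost everywhere. The set where they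
differ is thus null for every ergodic measure, and it must be shown null for every stationary one
(`null_of_forall_ergodic`). The ergodic decomposition is not needed: a stationary measure charging
the set charges a closed subset `C`. On the compact convex set of stationary measures, `μ ↦ μ C` is
upper semicontinuous, its maximizers form a compact face, and an extreme point of that face is an
ergodic measure charging `C`.

2 → 1: let `p` be ergodic and `ψ_{p,W} = a ψ₁ + b ψ₂` with stationary `ψᵢ`. The input marginals of
the `ψᵢ` are dominated by multiples of `p`. Radon-Nikodym densities, chosen linearly by separability
of the output algebra, turn `ψᵢ` into a measurable family of functionals `φᵢ x`
(`exists_conditional_states`). Ergodicity makes `φᵢ x 1` constant, so these are states almost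
everywhere. On an exactly invariant set of full measure they are stationary and average to `W`.
Keeping `W` elsewhere yields stationary channels `W₁`, `W₂` with `W = a W₁ + b W₂` pointwise;
extremality identifies them, and hence `ψ₁ = ψ₂`. -/

theorem exists_eq_star_mul_self_of_nonneg {C : Type*} [NonUnitalCStarAlgebra C] [PartialOrder C]
    [StarOrderedRing C] {c : C} (hc : 0 ≤ c) : ∃ b, c = star b * b :=
  CStarAlgebra.nonneg_iff_eq_star_mul_self.1 hc

/-- Positivity can be tested along a jointly injective family of `*`-homomorphisms. -/
theorem nonneg_of_forall_map_nonneg {ι C D : Type*} [NonUnitalCStarAlgebra C] [PartialOrder C]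
    [StarOrderedRing C] [NonUnitalCStarAlgebra D] [PartialOrder D] [StarOrderedRing D]
    (φ : ι → C →⋆ₙₐ[ℂ] D) (hinj : ∀ a b, (∀ i, φ i a = φ i b) → a = b) {c : C}
    (hc : ∀ i, 0 ≤ φ i c) : 0 ≤ c := by
  have hsa : IsSelfAdjoint c := hinj _ _ fun i => (map_star (φ i) c).trans (hc i).isSelfAdjoint
  refine CStarAlgebra.nonneg_iff_isSelfAdjoint_and_negPart_eq_zero.2
    ⟨hsa, hinj _ _ fun i => ?_⟩
  -- A `*`-homomorphism commutes with the functional calculus, so it sends the negative part of `c`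
  -- to the negative part of `φ i c`, which vanishes.
  rw [map_zero, ← (CStarAlgebra.nonneg_iff_isSelfAdjoint_and_negPart_eq_zero.1 (hc i)).2,
    CFC.negPart_def, CFC.negPart_def]
  exact NonUnitalStarAlgHomClass.map_cfcₙ (φ i) _ c
    (hφ := AddMonoidHomClass.continuous_of_bound (φ i) 1 fun a => by
      rw [one_mul]; exact NonUnitalStarAlgHom.norm_apply_le (φ i) a)

variable {A : Type*} [MeasurableSpace A] {B : Type*} [CStarAlgebra B]

/-- A positive matrix over `B` has the form `N* N`; this expansion reduces positive semidefiniteness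
of its entrywise image to positivity of `φ` on squares. -/
theorem quadraticForm_map_star_mul {k : ℕ} (φ : B →ₗ[ℂ] ℂ) (N : CStarMatrix (Fin k) (Fin k) B)
    (v : Fin k → ℂ) :
    star v ⬝ᵥ (CStarMatrix.ofMatrix.symm ((star N * N).map φ)).mulVec v =
      ∑ l, φ (star (∑ j, v j • N l j) * ∑ j, v j • N l j) := by
  simp only [dotProduct, Matrix.mulVec, CStarMatrix.ofMatrix_symm_apply, CStarMatrix.map_apply,
    CStarMatrix.mul_apply, CStarMatrix.star_apply, star_sum, star_smul,
    map_sum, smul_mul_smul_comm, map_smul, smul_eq_mul, Pi.star_apply, Finset.mul_sum,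
    Finset.sum_mul]
  rw [Finset.sum_congr rfl fun i _ => Finset.sum_comm, Finset.sum_comm]
  refine Finset.sum_congr rfl fun l _ => ?_
  rw [Finset.sum_comm]
  exact Finset.sum_congr rfl fun i _ => Finset.sum_congr rfl fun j _ => by ring

theorem map_star_of_positive (φ : B →ₗ[ℂ] ℂ) (hφ : ∀ b, 0 ≤ φ (star b * b)) (b : B) :
    φ (star b) = star (φ b) := by
  let _ := CStarAlgebra.spectralOrder B
  let _ := CStarAlgebra.spectralOrderedRing B
  exact map_star (PositiveLinearMap.mk₀ φ fun x hx => by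
    obtain ⟨s, rfl⟩ := CStarAlgebra.nonneg_iff_eq_star_mul_self.1 hx
    exact hφ s) b

open scoped MatrixOrder in
/-- A positive functional is completely positive. -/
theorem cstarMatrix_map_nonneg [PartialOrder B] [StarOrderedRing B] (φ : B →ₗ[ℂ] ℂ)
    (hφ : ∀ b, 0 ≤ φ (star b * b)) {k : ℕ} {M : CStarMatrix (Fin k) (Fin k) B} (hM : 0 ≤ M) :
    0 ≤ M.map φ := by
  have key : (CStarMatrix.ofMatrix.symm (M.map φ)).PosSemidef := by
    obtain ⟨N, rfl⟩ := exists_eq_star_mul_self_of_nonneg hM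
    have hq (v : Fin k → ℂ) :
        0 ≤ star v ⬝ᵥ (CStarMatrix.ofMatrix.symm ((star N * N).map φ)).mulVec v := by
      rw [quadraticForm_map_star_mul]
      exact Finset.sum_nonneg fun l _ => hφ _
    refine Matrix.PosSemidef.of_dotProduct_mulVec_nonneg ?_ hq
    refine Matrix.IsHermitian.ext fun i j => ?_
    have hN : star ((star N * N) j i) = (star N * N) i j :=
      CStarMatrix.ext_iff.2 (IsSelfAdjoint.star_mul_self N).star_eq i j
    change star (φ ((star N * N) j i)) = φ ((star N * N) i j)
    rw [← hN, map_star_of_positive φ hφ]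
  exact map_nonneg (CStarMatrix.ofMatrixStarAlgEquiv (n := Fin k) (A := ℂ))
    (Matrix.nonneg_iff_posSemidef.2 key)

namespace BddMeas

/-- Evaluation at a point. -/
def eval (x : ℤ → A) : BddMeas A →⋆ₐ[ℂ] ℂ where
  toFun f := f x
  map_one' := rfl
  map_mul' _ _ := rfl
  map_zero' := rfl
  map_add' _ _ := rfl
  commutes' _ := rfl
  map_star' _ := rfl

theorem apply_nonneg {f : BddMeas A} (hf : 0 ≤ f) (x : ℤ → A) : 0 ≤ f x := by
  obtain ⟨g, rfl⟩ := exists_eq_star_mul_self_of_nonneg hf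
  exact star_mul_self_nonneg (g x)

/-- Matrices over the bounded measurable functions are ordered pointwise. -/
theorem cstarMatrix_nonneg {k : ℕ} {M : CStarMatrix (Fin k) (Fin k) (BddMeas A)}
    (h : ∀ x, 0 ≤ M.map (eval x)) : 0 ≤ M :=
  nonneg_of_forall_map_nonneg
    (fun x => CStarMatrix.mapₙₐ (eval x : BddMeas A →⋆ₙₐ[ℂ] ℂ))
    (fun _ _ hMN => CStarMatrix.ext fun i j => BddMeas.ext fun x =>
      CStarMatrix.ext_iff.2 (hMN x) i j) h

end BddMeas

/-- Matrices over `BddMeas A` are positive as soon as they are so at every point, and evaluation at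
a point turns `φ` into a positive functional, which is completely positive. -/
theorem isCP_of_pointwise [PartialOrder B] [StarOrderedRing B] (φ : B →ₗ[ℂ] BddMeas A)
    (h : ∀ b x, 0 ≤ φ (star b * b) x) : IsCP φ :=
  ⟨{ φ with
      map_cstarMatrix_nonneg' := fun _ _ hM => BddMeas.cstarMatrix_nonneg fun x =>
        cstarMatrix_map_nonneg ((BddMeas.eval x).toAlgHom.toLinearMap ∘ₗ φ) (fun b => h b x) hM },
    rfl⟩

theorem IsCP.apply_nonneg [PartialOrder B] [StarOrderedRing B] {φ : B →ₗ[ℂ] BddMeas A}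
    (h : IsCP φ) (b : B) (x : ℤ → A) : 0 ≤ φ (star b * b) x := by
  obtain ⟨Φ, rfl⟩ := h
  exact BddMeas.apply_nonneg (map_nonneg Φ (star_mul_self_nonneg b)) x

end CompletePositivity

/-! ### The correspondence between `W`, `K` and `E`. -/

section Associated

open MeasureTheory

variable {A : Type*} [MeasurableSpace A] {B : Type*} [CStarAlgebra B]

namespace CQChannel

theorem isCP_mapK [PartialOrder B] [StarOrderedRing B] (W : CQChannel A B) : IsCP W.mapK :=
  isCP_of_pointwise _ fun b x => (W.isState x).1 b

theorem mapK_mem_setK [PartialOrder B] [StarOrderedRing B] {T : B →⋆ₐ[ℂ] B} {W : CQChannel A B}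
    (hW : W.IsStationary T) : W.mapK ∈ setK A T :=
  ⟨W.isCP_mapK, BddMeas.ext fun x => (W.isState x).2, fun b => BddMeas.ext fun x => (hW x b).symm⟩

/-- The channel of a completely positive unital map. -/
def ofK [PartialOrder B] [StarOrderedRing B] (K : B →ₗ[ℂ] BddMeas A) (hK : IsCP K)
    (h1 : K 1 = 1) : CQChannel A B where
  toFun x := (BddMeas.eval x).toAlgHom.toLinearMap ∘ₗ K
  measurable b := (K b).measurable
  isState x := ⟨fun b => hK.apply_nonneg b x, congrArg (BddMeas.eval x) h1⟩

variable [Nontrivial B]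

theorem isCP_mapE (W : CQChannel A B) : IsCP W.mapE :=
  isCP_of_pointwise _ fun t x => (W.isState x).1 (t x)

theorem mapE_one_tmul (W : CQChannel A B) (b : B) : W.mapE (Joint.tmul 1 b) = W.mapK b := by
  rw [mapE_tmul, one_mul]

theorem mapE_mem_setE {T : B →⋆ₐ[ℂ] B} {W : CQChannel A B} (hW : W.IsStationary T) :
    W.mapE ∈ setE A T :=
  ⟨W.isCP_mapE, BddMeas.ext fun x => (W.isState x).2,
    fun f b => by rw [mapE_one_tmul, mapE_tmul],
    fun t => BddMeas.ext fun x => (hW x (t (shiftIn x))).symm⟩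

end CQChannel

theorem Joint.tmul_one_mul [Nontrivial B] (b c : B) :
    (Joint.tmul 1 (b * c) : Joint A B) = Joint.tmul 1 b * Joint.tmul 1 c := by
  refine Joint.ext fun x => ?_
  change _ = Joint.tmul 1 b x * Joint.tmul 1 c x
  simp only [Joint.tmul_apply, show (1 : BddMeas A) x = 1 from rfl, one_smul]

/-- `E ↦ E(1 ⊗ ·)`. -/
def restrictE [Nontrivial B] (E : Joint A B →ₗ[ℂ] BddMeas A) : B →ₗ[ℂ] BddMeas A where
  toFun b := E (Joint.tmul 1 b)
  map_add' b c := by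
    rw [← map_add]
    exact congrArg E (Joint.ext fun x => by
      change _ = Joint.tmul 1 b x + Joint.tmul 1 c x
      simp only [Joint.tmul_apply, smul_add])
  map_smul' r b := by
    rw [RingHom.id_apply, ← map_smul]
    exact congrArg E (Joint.ext fun x => by
      change _ = r • Joint.tmul 1 b x
      simp only [Joint.tmul_apply, smul_comm r])

theorem restrictE_mem_setK [Nontrivial B] [PartialOrder B] [StarOrderedRing B] {T : B →⋆ₐ[ℂ] B}
    {E : Joint A B →ₗ[ℂ] BddMeas A} (hE : E ∈ setE A T) : restrictE E ∈ setK A T := by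
  obtain ⟨hCP, h1, hmul, hT⟩ := hE
  refine ⟨isCP_of_pointwise _ fun b x => ?_, ?_, fun b => ?_⟩
  · have h : (Joint.tmul 1 (star b * b) : Joint A B) =
        star (Joint.tmul 1 b) * Joint.tmul 1 b := by
      rw [Joint.tmul_one_mul]
      congr 1
      refine Joint.ext fun x => ?_
      change _ = star (Joint.tmul 1 b x)
      simp only [Joint.tmul_apply, show (1 : BddMeas A) x = 1 from rfl, one_smul]
    change 0 ≤ E (Joint.tmul 1 (star b * b)) x
    rw [h]
    exact hCP.apply_nonneg _ x
  · rw [← h1]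
    exact congrArg E (Joint.ext fun x => by
      rw [Joint.tmul_apply, show (1 : BddMeas A) x = 1 from rfl, one_smul]; rfl)
  · change E _ = (E _).shift
    rw [← hT, Joint.shift_tmul]
    rfl

/-- Currying is an affine bijection between the two convex sets, and `ChannelEq` unfolds to
`MapKEq`, so the hypotheses transfer without computation. -/
theorem isExtremalIn_setK_iff [PartialOrder B] [StarOrderedRing B] {T : B →⋆ₐ[ℂ] B}
    {W : CQChannel A B} (hW : W.IsStationary T) :
    IsExtremalIn MapKEq (setK A T) W.mapK ↔
      IsExtremalIn ChannelEq (stationaryChannels A T) W.toFun := by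
  constructor
  · rintro ⟨-, h⟩
    refine ⟨⟨W, hW, rfl⟩, ?_⟩
    rintro _ ⟨W₁, hW₁, rfl⟩ _ ⟨W₂, hW₂, rfl⟩ a ha heq
    exact h _ (W₁.mapK_mem_setK hW₁) _ (W₂.mapK_mem_setK hW₂) a ha heq
  · rintro ⟨-, h⟩
    refine ⟨W.mapK_mem_setK hW, fun K₁ hK₁ K₂ hK₂ a ha heq => ?_⟩
    exact h _ ⟨.ofK K₁ hK₁.1 hK₁.2.1, fun x b => (congrArg (BddMeas.eval x) (hK₁.2.2 b)).symm, rfl⟩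
      _ ⟨.ofK K₂ hK₂.1 hK₂.2.1, fun x b => (congrArg (BddMeas.eval x) (hK₂.2.2 b)).symm, rfl⟩
      a ha heq

section

variable [Nontrivial B]

/-- Only the module identity is assumed, so that the lemma also applies to a convex combination
without showing that it lies in `setE`. -/
theorem mapEEq_iff {E₁ E₂ : Joint A B →ₗ[ℂ] BddMeas A}
    (h₁ : ∀ f b, E₁ (Joint.tmul f b) = f * E₁ (Joint.tmul 1 b))
    (h₂ : ∀ f b, E₂ (Joint.tmul f b) = f * E₂ (Joint.tmul 1 b)) :
    MapEEq E₁ E₂ ↔ MapKEq (restrictE E₁) (restrictE E₂) := by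
  refine ⟨fun h p _ hp f b => ?_, fun h p _ hp f b => ?_⟩
  · have := h p hp f b
    rwa [h₁, h₂] at this
  · rw [h₁, h₂]
    exact h p hp f b

theorem restrictE_mapE (W : CQChannel A B) : restrictE W.mapE = W.mapK :=
  LinearMap.ext fun b => W.mapE_one_tmul b

theorem convex_combination_tmul {E₁ E₂ : Joint A B →ₗ[ℂ] BddMeas A}
    (h₁ : ∀ f b, E₁ (Joint.tmul f b) = f * E₁ (Joint.tmul 1 b))
    (h₂ : ∀ f b, E₂ (Joint.tmul f b) = f * E₂ (Joint.tmul 1 b)) (r s : ℝ) (f : BddMeas A) (b : B) :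
    (r • E₁ + s • E₂) (Joint.tmul f b) = f * (r • E₁ + s • E₂) (Joint.tmul 1 b) := by
  simp only [LinearMap.add_apply, LinearMap.smul_apply]
  rw [h₁, h₂, mul_add, mul_smul_comm, mul_smul_comm]

end

/-- `restrictE` is affine and carries `setE` into `setK`. In the other direction, an element of
`setK` is lifted through the channel it defines. -/
theorem isExtremalIn_setE_iff [Nontrivial B] [PartialOrder B] [StarOrderedRing B]
    {T : B →⋆ₐ[ℂ] B} {W : CQChannel A B} (hW : W.IsStationary T) :
    IsExtremalIn MapEEq (setE A T) W.mapE ↔ IsExtremalIn MapKEq (setK A T) W.mapK := by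
  constructor
  · rintro ⟨-, h⟩
    refine ⟨W.mapK_mem_setK hW, fun K₁ hK₁ K₂ hK₂ a ha heq => ?_⟩
    let W₁ := CQChannel.ofK K₁ hK₁.1 hK₁.2.1
    let W₂ := CQChannel.ofK K₂ hK₂.1 hK₂.2.1
    have hW₁ : W₁.IsStationary T := fun x b => (congrArg (BddMeas.eval x) (hK₁.2.2 b)).symm
    have hW₂ : W₂.IsStationary T := fun x b => (congrArg (BddMeas.eval x) (hK₂.2.2 b)).symm
    have hE₁ := W₁.mapE_mem_setE hW₁
    have hE₂ := W₂.mapE_mem_setE hW₂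
    have := h _ hE₁ _ hE₂ a ha ((mapEEq_iff (W.mapE_mem_setE hW).2.2.1
      (convex_combination_tmul hE₁.2.2.1 hE₂.2.2.1 _ _)).2 ?_)
    · rw [mapEEq_iff hE₁.2.2.1 hE₂.2.2.1, restrictE_mapE, restrictE_mapE] at this
      exact this
    · rw [restrictE_mapE]
      have h12 : restrictE (a • W₁.mapE + (1 - a) • W₂.mapE) = a • K₁ + (1 - a) • K₂ :=
        LinearMap.ext fun b => congrArg₂ (fun u v => a • u + (1 - a) • v)
          (W₁.mapE_one_tmul b) (W₂.mapE_one_tmul b)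
      rwa [h12]
  · rintro ⟨-, h⟩
    refine ⟨W.mapE_mem_setE hW, fun E₁ hE₁ E₂ hE₂ a ha heq => ?_⟩
    rw [mapEEq_iff hE₁.2.2.1 hE₂.2.2.1]
    rw [mapEEq_iff (W.mapE_mem_setE hW).2.2.1
      (convex_combination_tmul hE₁.2.2.1 hE₂.2.2.1 _ _), restrictE_mapE] at heq
    exact h _ (restrictE_mem_setK hE₁) _ (restrictE_mem_setK hE₂) a ha heq

end Associated

/-! ### Null sets of ergodic and of invariant measures. -/

section ErgodicMeasures

open MeasureTheory Filter Topology
open scoped ENNReal BoundedContinuousFunction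

variable {X : Type*} [MeasurableSpace X] [TopologicalSpace X] [BorelSpace X]

/-- Expresses that the maximizers of an affine functional form a face. -/
theorem le_left_of_le_convex_combination {a b x y m : ℝ} (ha : 0 < a) (hb : 0 < b)
    (hab : a + b = 1) (h : m ≤ a * x + b * y) (hy : y ≤ m) : m ≤ x := by
  have h1 : a * m + b * m = m := by rw [← add_mul, hab, one_mul]
  have h2 := mul_le_mul_of_nonneg_left hy hb.le
  exact le_of_mul_le_mul_left (by linarith : a * m ≤ a * x) ha

/-- This is the portmanteau inequality for closed sets. -/
theorem upperSemicontinuous_measure_of_isClosed [HasOuterApproxClosed X] {C : Set X}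
    (hC : IsClosed C) : UpperSemicontinuous fun μ : ProbabilityMeasure X => (μ : Measure X) C :=
  fun _ _ hy => eventually_lt_of_limsup_lt
    ((ProbabilityMeasure.limsup_measure_closed_le_of_tendsto tendsto_id hC).trans_lt hy)

/-- On a compact metrizable space, a closed set charged by an invariant probability measure is
charged by an ergodic one. -/
theorem exists_ergodic_of_isClosed [CompactSpace X] [T2Space X] [HasOuterApproxClosed X]
    {f : X → X} (hf : Continuous f) {C : Set X} (hC : IsClosed C) (p : Measure X)
    [IsProbabilityMeasure p] (hp : MeasurePreserving f p p) (hpC : p C ≠ 0) :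
    ∃ q : Measure X, IsProbabilityMeasure q ∧ Ergodic f q ∧ q C ≠ 0 := by
  let S : Set (ProbabilityMeasure X) := {μ | MeasurePreserving f μ.toMeasure μ.toMeasure}
  have hS : S = {μ | μ.map hf.measurable.aemeasurable = μ} := by
    ext μ
    refine ⟨fun h => Subtype.ext h.map_eq, fun h => ⟨hf.measurable, congrArg Subtype.val h⟩⟩
  have hSc : IsClosed S := by
    rw [hS]
    exact isClosed_eq (ProbabilityMeasure.continuous_map hf) continuous_id
  have hF := upperSemicontinuous_measure_of_isClosed hC
  have hne : S.Nonempty := ⟨⟨p, inferInstance⟩, hp⟩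
  obtain ⟨μ₀, hμ₀, hmax⟩ := (hF.upperSemicontinuousOn S).exists_isMaxOn hne hSc.isCompact
  -- By the choice of `μ₀`, these are exactly the invariant measures that maximize the mass of `C`.
  let M : Set (ProbabilityMeasure X) := S ∩ {μ | μ₀.toMeasure C ≤ μ.toMeasure C}
  have hM : IsCompact M := (hSc.inter (hF.isClosed_preimage _)).isCompact
  -- Extreme points need a vector space: `Φ` embeds the probability measures affinely into a product
  -- of lines, where the Krein-Milman argument gives an extreme point of the compact image of `M`.
  let Φ : ProbabilityMeasure X → (X →ᵇ ℝ) → ℝ := fun μ g => ∫ x, g x ∂μ.toMeasure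
  have hΦ : Continuous Φ :=
    continuous_pi fun g => ProbabilityMeasure.continuous_integral_boundedContinuousFunction g
  obtain ⟨_, ⟨q, hq, rfl⟩, hext⟩ := (hM.image hΦ).extremePoints_nonempty
    ⟨Φ μ₀, μ₀, ⟨hμ₀, le_refl (μ₀.toMeasure C)⟩, rfl⟩
  refine ⟨q, inferInstance, Ergodic.of_mem_extremePoints ⟨⟨hq.1, inferInstance⟩, ?_⟩, ?_⟩
  · rintro ν₁ ⟨hν₁, hν₁'⟩ ν₂ ⟨hν₂, hν₂'⟩ ⟨a, b, ha, hb, hab, hqab⟩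
    have ha' : a ≠ ∞ := ((le_self_add.trans hab.le).trans_lt ENNReal.one_lt_top).ne
    have hb' : b ≠ ∞ := ((le_add_self.trans hab.le).trans_lt ENNReal.one_lt_top).ne
    have hα : 0 < a.toReal := ENNReal.toReal_pos ha.ne' ha'
    have hβ : 0 < b.toReal := ENNReal.toReal_pos hb.ne' hb'
    have hαβ : a.toReal + b.toReal = 1 := by
      rw [← ENNReal.toReal_add ha' hb', hab, ENNReal.toReal_one]
    -- Neither component of `q` can exceed the maximum while their average attains it; both
    -- therefore lie in `M`, and extremality within `M` applies.
    have hle {ν : Measure X} (hν : MeasurePreserving f ν ν) (hν' : IsProbabilityMeasure ν) :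
        ν.real C ≤ μ₀.toMeasure.real C :=
      ENNReal.toReal_mono (measure_ne_top _ _) (hmax (a := ⟨ν, hν'⟩) hν)
    have hqC : μ₀.toMeasure.real C ≤ a.toReal * ν₁.real C + b.toReal * ν₂.real C := by
      refine (ENNReal.toReal_mono (measure_ne_top _ _) hq.2).trans_eq ?_
      rw [← hqab, Measure.add_apply, Measure.smul_apply, Measure.smul_apply, smul_eq_mul,
        smul_eq_mul, ENNReal.toReal_add (by finiteness) (by finiteness), ENNReal.toReal_mul,
        ENNReal.toReal_mul]
      rfl
    have hm₁ := hle hν₁ hν₁'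
    have hm₂ := hle hν₂ hν₂'
    have hM₁ : (⟨ν₁, hν₁'⟩ : ProbabilityMeasure X) ∈ M :=
      ⟨hν₁, (ENNReal.toReal_le_toReal (measure_ne_top _ _) (measure_ne_top ν₁ _)).1
        (le_left_of_le_convex_combination hα hβ hαβ hqC hm₂)⟩
    have hM₂ : (⟨ν₂, hν₂'⟩ : ProbabilityMeasure X) ∈ M :=
      ⟨hν₂, (ENNReal.toReal_le_toReal (measure_ne_top _ _) (measure_ne_top ν₂ _)).1
        (le_left_of_le_convex_combination hβ hα ((add_comm _ _).trans hαβ)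
          (hqC.trans_eq (add_comm _ _)) hm₁)⟩
    have hΦq := hext ⟨_, hM₁, rfl⟩ ⟨_, hM₂, rfl⟩ ⟨a.toReal, b.toReal, hα, hβ, hαβ, ?_⟩
    · exact ext_of_forall_integral_eq_of_IsFiniteMeasure fun g => congrFun hΦq g
    · funext g
      change a.toReal * ∫ x, g x ∂ν₁ + b.toReal * ∫ x, g x ∂ν₂ = ∫ x, g x ∂q.toMeasure
      rw [← hqab, integral_add_measure ((g.integrable ν₁).smul_measure ha')
        ((g.integrable ν₂).smul_measure hb'), integral_smul_measure, integral_smul_measure]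
      rfl
  · have h1 : p C ≤ μ₀.toMeasure C := hmax (a := ⟨p, inferInstance⟩) hp
    exact ((pos_iff_ne_zero.2 hpC).trans_le (h1.trans hq.2)).ne'

/-- On a compact metrizable space, a set which is null for all ergodic probability measures is null
for all invariant probability measures. -/
theorem null_of_forall_ergodic [CompactSpace X] [TopologicalSpace.MetrizableSpace X]
    {f : X → X} (hf : Continuous f) {N : Set X} (hN : MeasurableSet N)
    (h : ∀ q : Measure X, IsProbabilityMeasure q → Ergodic f q → q N = 0) (p : Measure X)
    [IsProbabilityMeasure p] (hp : MeasurePreserving f p p) : p N = 0 := by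
  let _ := TopologicalSpace.metrizableSpaceMetric X
  by_contra h0
  -- Inner regularity replaces `N` by a closed set, for which the mass is upper semicontinuous.
  obtain ⟨C, hCN, hC, hpC⟩ :=
    hN.exists_lt_isClosed_of_ne_top (measure_ne_top p N) (pos_iff_ne_zero.2 h0)
  obtain ⟨q, hq, hqe, hqC⟩ := exists_ergodic_of_isClosed hf hC p hp hpC.ne'
  exact hqC (measure_mono_null hCN (h q hq hqe))

end ErgodicMeasures

/-! ### Application to the shift on sequences. -/

section SequenceSpace

open MeasureTheory

variable {A : Type*} [Finite A] [MeasurableSpace A] [DiscreteMeasurableSpace A]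

theorem null_of_forall_ergodic_shiftIn {N : Set (ℤ → A)} (hN : MeasurableSet N)
    (h : ∀ q : Measure (ℤ → A), IsProbabilityMeasure q → Ergodic shiftIn q → q N = 0)
    (p : Measure (ℤ → A)) [IsProbabilityMeasure p] (hp : MeasurePreserving shiftIn p p) :
    p N = 0 := by
  -- With the discrete topology on the finite set `A`, the sequence space is compact and metrizable,
  -- the shift is continuous, and the cylinder `σ`-algebra is the Borel one.
  let _ : TopologicalSpace A := ⊥
  have : DiscreteTopology A := ⟨rfl⟩
  have : BorelSpace A := inferInstance
  exact null_of_forall_ergodic (continuous_pi fun n => continuous_apply (n + 1)) hN h p hp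

end SequenceSpace

/-! ### Expectation functionals. -/

section Expectation

open MeasureTheory

variable {A : Type*} [MeasurableSpace A] {p : Measure (ℤ → A)} [IsProbabilityMeasure p]

namespace BddMeas

theorem integrable (f : BddMeas A) : Integrable (f : (ℤ → A) → ℂ) p :=
  Integrable.of_bound f.measurable.aestronglyMeasurable ‖f‖
    (Filter.Eventually.of_forall f.norm_apply_le)

theorem expect_apply (f : BddMeas A) : expect p f = ∫ x, f x ∂p := rfl

theorem isState_expect : IsState (expect p) :=
  ⟨fun f => integral_nonneg fun x => star_mul_self_nonneg (f x),
    (integral_const (1 : ℂ)).trans (by simp)⟩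

/-- The expectation of a shifted function under a stationary measure. -/
theorem expect_shift (hp : MeasurePreserving shiftIn p p) (f : BddMeas A) :
    expect p f.shift = expect p f := by
  conv_rhs => rw [expect_apply, ← hp.map_eq]
  exact (integral_map hp.measurable.aemeasurable f.measurable.aestronglyMeasurable).symm

/-- A bounded function is determined almost everywhere by its correlations. -/
theorem ae_eq_of_forall_expect_mul_eq {u v : BddMeas A}
    (h : ∀ f, expect p (f * u) = expect p (f * v)) : ∀ᵐ x ∂p, u x = v x := by
  -- Testing against the conjugate of `u - v` makes the integral of `|u - v|²` vanish.
  have h0 : expect p (star (u - v) * (u - v)) = 0 := by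
    rw [mul_sub, map_sub, h, sub_self]
  have hn : ∫ x, ‖u x - v x‖ ^ 2 ∂p = 0 := by
    rw [← Complex.ofReal_inj, ← integral_complex_ofReal, Complex.ofReal_zero, ← h0]
    refine integral_congr_ae (Filter.Eventually.of_forall fun x => ?_)
    exact (Complex.ofReal_pow _ _).trans (Complex.conj_mul' (u x - v x)).symm
  have hi : Integrable (fun x => ‖u x - v x‖ ^ 2) p :=
    Integrable.of_bound ((u - v).measurable.norm.pow_const 2).aestronglyMeasurable (‖u - v‖ ^ 2)
      (Filter.Eventually.of_forall fun x => by
        rw [Real.norm_of_nonneg (by positivity)]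
        gcongr
        exact (u - v).norm_apply_le x)
  filter_upwards [(integral_eq_zero_iff_of_nonneg (fun x => by positivity) hi).1 hn] with x hx
  simpa [sub_eq_zero] using hx

end BddMeas

end Expectation

/-! ### Joint states, and ergodic channels are extremal. -/

section JointStates

open MeasureTheory

variable {A : Type*} [MeasurableSpace A] {B : Type*} [CStarAlgebra B]

theorem IsState.continuous {ψ : B →ₗ[ℂ] ℂ} (h : IsState ψ) : Continuous ψ :=
  AddMonoidHomClass.continuous_of_bound ψ 4 h.norm_le

theorem Joint.linearMap_eq [Nontrivial B] {ψ χ : Joint A B →ₗ[ℂ] ℂ} (hψ : Continuous ψ)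
    (hχ : Continuous χ) (h : ∀ f b, ψ (Joint.tmul f b) = χ (Joint.tmul f b)) : ψ = χ :=
  LinearMap.ext fun t => Joint.induction (P := fun t => ψ t = χ t) (isClosed_eq hψ hχ) h
    (fun s t hs ht => by rw [map_add, map_add, hs, ht]) t

theorem IsState.convex {ψ χ : B →ₗ[ℂ] ℂ} (hψ : IsState ψ) (hχ : IsState χ) {a b : ℝ}
    (ha : 0 ≤ a) (hb : 0 ≤ b) (hab : a + b = 1) : IsState (a • ψ + b • χ) := by
  refine ⟨fun c => ?_, ?_⟩
  · exact add_nonneg (smul_nonneg ha (hψ.1 c)) (smul_nonneg hb (hχ.1 c))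
  · change a • ψ 1 + b • χ 1 = 1
    rw [hψ.2, hχ.2, ← add_smul, hab, one_smul]

variable [Nontrivial B] {T : B →⋆ₐ[ℂ] B}

theorem CQChannel.isState_jointState (W : CQChannel A B) (p : Measure (ℤ → A))
    [IsProbabilityMeasure p] : IsState (W.jointState p) := by
  refine ⟨fun t => integral_nonneg fun x => (W.isState x).1 (t x), ?_⟩
  rw [← (BddMeas.isState_expect (p := p)).2]
  exact congrArg (BddMeas.expect p) (BddMeas.ext fun x => (W.isState x).2)

theorem CQChannel.IsStationary.jointState_mem {W : CQChannel A B} (hW : W.IsStationary T)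
    {p : Measure (ℤ → A)} [IsProbabilityMeasure p] (hp : MeasurePreserving shiftIn p p) :
    W.jointState p ∈ stationaryStates (Joint.shift T) := by
  refine ⟨W.isState_jointState p, fun t => ?_⟩
  refine Eq.trans ?_ (BddMeas.expect_shift hp (W.mapE t))
  exact congrArg (BddMeas.expect p) (BddMeas.ext fun x => (hW x (t (shiftIn x))).symm)

theorem CQChannel.IsErgodic.isExtremalIn [Finite A] [DiscreteMeasurableSpace A]
    {W : CQChannel A B} (hW : W.IsErgodic T) :
    IsExtremalIn ChannelEq (stationaryChannels A T) W.toFun := by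
  refine ⟨⟨W, hW.1, rfl⟩, ?_⟩
  rintro _ ⟨W₁, hW₁, rfl⟩ _ ⟨W₂, hW₂, rfl⟩ a ha heq p _ hp f b
  have herg (q : Measure (ℤ → A)) (_ : IsProbabilityMeasure q) (hq : Ergodic shiftIn q) :
      ∀ᵐ x ∂q, W₁.mapK b x = W₂.mapK b x := by
    have hmp := hq.toMeasurePreserving
    -- The decomposition of `W` is given only on elementary tensors; continuity of states extends it
    -- to the whole algebra.
    have hcomb : a • W₁.jointState q + (1 - a) • W₂.jointState q = W.jointState q := by
      refine Joint.linearMap_eq ((W₁.isState_jointState q).convex (W₂.isState_jointState q)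
        ha.1.le (sub_nonneg.2 ha.2.le) (add_sub_cancel _ _)).continuous
        (W.isState_jointState q).continuous fun f b => ?_
      rw [jointState_tmul, heq q hmp f b]
      change a • W₁.jointState q (Joint.tmul f b) + (1 - a) • W₂.jointState q (Joint.tmul f b) =
        BddMeas.expect q (f * (a • W₁.mapK b + (1 - a) • W₂.mapK b))
      rw [mul_add, mul_smul_comm, mul_smul_comm, map_add, LinearMap.map_smul_of_tower,
        LinearMap.map_smul_of_tower, jointState_tmul, jointState_tmul]
      rfl
    have h12 : W₁.jointState q = W₂.jointState q := by
      have hext := hW.2 q hq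
      rw [IsErgodicState, mem_extremePoints] at hext
      obtain ⟨h1, h2⟩ := hext.2 _ (hW₁.jointState_mem hmp) _ (hW₂.jointState_mem hmp)
        ⟨a, 1 - a, ha.1, sub_pos.2 ha.2, add_sub_cancel _ _, hcomb⟩
      rw [h1, h2]
    refine BddMeas.ae_eq_of_forall_expect_mul_eq fun f => ?_
    rw [← mapE_tmul, ← mapE_tmul]
    exact LinearMap.congr_fun h12 (Joint.tmul f b)
  -- The exceptional set may depend on `b`, since `ChannelEq` is tested for one `b` at a time.
  have hnull : p {x | ¬ W₁.mapK b x = W₂.mapK b x} = 0 :=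
    null_of_forall_ergodic_shiftIn
      (measurableSet_eq_fun (W₁.mapK b).measurable (W₂.mapK b).measurable).compl herg p hp
  refine integral_congr_ae ?_
  filter_upwards [show ∀ᵐ x ∂p, W₁.mapK b x = W₂.mapK b x from hnull] with x hx
  exact congrArg (f x * ·) hx

end JointStates

/-! ### Bounded densities of dominated functionals. -/

section Density

open MeasureTheory

/-- The approximation is uniform: a disc containing the range is covered by finitely many `ε`-balls,
and values are rounded to the nearest centre. -/
theorem exists_simpleFunc_norm_sub_lt {X : Type*} [MeasurableSpace X] {f : X → ℂ}
    (hf : Measurable f) {C : ℝ} (hC : ∀ x, ‖f x‖ ≤ C) {ε : ℝ} (hε : 0 < ε) :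
    ∃ s : SimpleFunc X ℂ, ∀ x, ‖f x - s x‖ < ε := by
  let e := TopologicalSpace.denseSeq ℂ
  obtain ⟨t, ht⟩ := (isCompact_closedBall (0 : ℂ) C).elim_finite_subcover
    (fun n => Metric.ball (e n) ε) (fun n => Metric.isOpen_ball) fun z _ => by
      obtain ⟨n, hn⟩ := (TopologicalSpace.denseRange_denseSeq ℂ).exists_dist_lt z hε
      exact Set.mem_iUnion.2 ⟨n, hn⟩
  -- `nearestPt e N` chooses among `e 0, …, e N`, so `N = t.sup id` makes all centres indexed by `t`
  -- available.
  refine ⟨(SimpleFunc.nearestPt e (t.sup id)).comp f hf, fun x => ?_⟩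
  obtain ⟨n, hn, hx⟩ := Set.mem_iUnion₂.1 (ht (mem_closedBall_zero_iff.2 (hC x)))
  have h := (SimpleFunc.edist_nearestPt_le e (f x) (Finset.le_sup (f := id) hn)).trans_lt
    (show edist (e n) (f x) < ENNReal.ofReal ε by
      rw [edist_comm, edist_lt_ofReal]; exact hx)
  rwa [edist_lt_ofReal, dist_comm, dist_eq_norm] at h

variable {A : Type*} [MeasurableSpace A]

namespace BddMeas

/-- The indicator function of a measurable set. -/
def ind {s : Set (ℤ → A)} (hs : MeasurableSet s) : BddMeas A :=
  mk (s.indicator 1) (measurable_const.indicator hs) 1 fun x => by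
    by_cases hx : x ∈ s <;> simp [hx]

theorem ind_of_mem {s : Set (ℤ → A)} (hs : MeasurableSet s) {x : ℤ → A} (hx : x ∈ s) :
    ind hs x = 1 :=
  Set.indicator_of_mem hx _

theorem ind_of_notMem {s : Set (ℤ → A)} (hs : MeasurableSet s) {x : ℤ → A} (hx : x ∉ s) :
    ind hs x = 0 :=
  Set.indicator_of_notMem hx _

theorem star_ind_mul_ind {s : Set (ℤ → A)} (hs : MeasurableSet s) :
    star (ind hs) * ind hs = ind hs := by
  refine ext fun x => ?_
  change star (ind hs x) * ind hs x = ind hs x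
  by_cases hx : x ∈ s
  · simp [ind_of_mem hs hx]
  · simp [ind_of_notMem hs hx]

theorem ind_union {s t : Set (ℤ → A)} (hs : MeasurableSet s) (ht : MeasurableSet t)
    (h : Disjoint s t) : ind (hs.union ht) = ind hs + ind ht :=
  ext fun x => congrFun (Set.indicator_union_of_disjoint h _) x

theorem integral_ind_mul (p : Measure (ℤ → A)) {s : Set (ℤ → A)} (hs : MeasurableSet s)
    (g : (ℤ → A) → ℂ) : ∫ x, ind hs x * g x ∂p = ∫ x in s, g x ∂p := by
  rw [← integral_indicator hs]
  refine integral_congr_ae (Filter.Eventually.of_forall fun x => ?_)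
  by_cases hx : x ∈ s
  · simp [ind_of_mem hs hx, hx]
  · simp [ind_of_notMem hs hx, hx]

theorem expect_ind_mul {p : Measure (ℤ → A)} [IsProbabilityMeasure p] {s : Set (ℤ → A)}
    (hs : MeasurableSet s) (g : BddMeas A) : expect p (ind hs * g) = ∫ x in s, g x ∂p :=
  integral_ind_mul p hs g

theorem norm_le_of_forall {f : BddMeas A} {C : ℝ} (hC : 0 ≤ C) (h : ∀ x, ‖f x‖ ≤ C) : ‖f‖ ≤ C :=
  lp.norm_le_of_forall_le hC h

/-- A closed additive property of bounded measurable functions which holds for multiples of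
indicator functions holds for all of them. -/
theorem induction {P : BddMeas A → Prop} (hP : IsClosed {f | P f})
    (hind : ∀ (c : ℂ) (s : Set (ℤ → A)) (hs : MeasurableSet s), P (c • ind hs))
    (hadd : ∀ f g, P f → P g → P (f + g)) (f : BddMeas A) : P f := by
  have hsimple (s : SimpleFunc (ℤ → A) ℂ) :
      ∀ f : BddMeas A, (∀ x, f x = s x) → P f := by
    induction s using SimpleFunc.induction with
    | const c hs =>
      intro f hf
      convert hind c _ hs
      refine ext fun x => (hf x).trans ?_
      change _ = c * ind hs x
      by_cases hx : x ∈ ‹Set (ℤ → A)›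
      · simp [ind_of_mem hs hx, hx]
      · simp [ind_of_notMem hs hx, hx]
    | @add u v _ hu hv =>
      intro f hf
      obtain ⟨C, hC⟩ := u.exists_forall_norm_le
      obtain ⟨D, hD⟩ := v.exists_forall_norm_le
      have h : f = mk u u.measurable C hC + mk v v.measurable D hD := ext hf
      rw [h]
      exact hadd _ _ (hu _ fun _ => rfl) (hv _ fun _ => rfl)
  refine hP.closure_subset (Metric.mem_closure_iff.2 fun ε hε => ?_)
  obtain ⟨s, hs⟩ := exists_simpleFunc_norm_sub_lt f.measurable f.norm_apply_le (half_pos hε)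
  obtain ⟨C, hC⟩ := s.exists_forall_norm_le
  refine ⟨mk s s.measurable C hC, hsimple s _ fun _ => rfl, ?_⟩
  rw [dist_eq_norm]
  exact (norm_le_of_forall (half_pos hε).le fun x => (hs x).le).trans_lt (half_lt_self hε)

end BddMeas

/-- The Radon-Nikodym theorem for a finitely additive set function which is bounded by a multiple
of a finite measure. -/
theorem exists_density_of_abs_le {X : Type*} [MeasurableSpace X] (p : Measure X)
    [IsFiniteMeasure p] {C : ℝ} (hC : 0 ≤ C) (m : Set X → ℝ)
    (hm : ∀ s, MeasurableSet s → |m s| ≤ C * p.real s)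
    (hadd : ∀ s t, MeasurableSet s → MeasurableSet t → Disjoint s t → m (s ∪ t) = m s + m t) :
    ∃ g : X → ℝ, Measurable g ∧ (∀ x, |g x| ≤ C) ∧
      ∀ s, MeasurableSet s → ∫ x in s, g x ∂p = m s := by
  classical
  -- Domination by the finite measure `C • p` upgrades finite to countable additivity. The value `0`
  -- off the measurable sets is the convention for vector measures.
  let ν : SignedMeasure X := VectorMeasure.of_additive_of_le_measure (μ := C.toNNReal • p)
    (fun s => if MeasurableSet s then m s else 0)
    (fun s => by
      split_ifs with hs
      · rw [← ofReal_norm, Real.norm_eq_abs]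
        refine (ENNReal.ofReal_le_ofReal (hm s hs)).trans_eq ?_
        rw [ENNReal.ofReal_mul hC, ofReal_measureReal]
        rfl
      · simp)
    (fun s t hs ht h => by simp [hs, ht, hs.union ht, hadd s t hs ht h])
    (fun s hs => by simp [hs])
  have hν {s : Set X} (hs : MeasurableSet s) : ν s = m s := if_pos hs
  have hac : VectorMeasure.AbsolutelyContinuous ν p.toENNRealVectorMeasure :=
    VectorMeasure.AbsolutelyContinuous.mk fun s hs hps => by
      rw [Measure.toENNRealVectorMeasure_apply_measurable hs] at hps
      rw [hν hs, ← abs_nonpos_iff]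
      simpa [measureReal_def, hps] using hm s hs
  have hint := SignedMeasure.integrable_rnDeriv ν p
  have hset {s : Set X} (hs : MeasurableSet s) : ∫ x in s, ν.rnDeriv p x ∂p = m s := by
    rw [← withDensityᵥ_apply hint hs, SignedMeasure.withDensityᵥ_rnDeriv_eq ν p hac, hν hs]
  have hup : ν.rnDeriv p ≤ᵐ[p] fun _ => C :=
    ae_le_of_forall_setIntegral_le hint (integrable_const C) fun s hs _ => by
      rw [hset hs, setIntegral_const, smul_eq_mul, mul_comm]
      exact (le_abs_self _).trans (hm s hs)
  have hlow : (fun _ => -C) ≤ᵐ[p] ν.rnDeriv p :=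
    ae_le_of_forall_setIntegral_le (integrable_const (-C)) hint fun s hs _ => by
      rw [hset hs, setIntegral_const, smul_eq_mul, mul_neg, mul_comm]
      exact (neg_le_neg (hm s hs)).trans (neg_abs_le _)
  -- Truncation makes the bound hold at every point and changes the density only on a null set.
  refine ⟨fun x => max (-C) (min (ν.rnDeriv p x) C),
    measurable_const.max ((SignedMeasure.measurable_rnDeriv ν p).min measurable_const),
    fun x => abs_le.2 ⟨le_max_left _ _, max_le (by linarith) (min_le_right _ _)⟩,
    fun s hs => ?_⟩
  rw [← hset hs]
  refine integral_congr_ae (ae_restrict_of_ae ?_)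
  filter_upwards [hup, hlow] with x h1 h2
  rw [min_eq_left h1, max_eq_right h2]

/-- A continuous functional on the bounded measurable functions which is dominated by a probability
measure has a bounded density. -/
theorem exists_density_of_norm_le {A : Type*} [MeasurableSpace A] (p : Measure (ℤ → A))
    [IsProbabilityMeasure p] (φ : BddMeas A →ₗ[ℂ] ℂ) (hφ : Continuous φ) {C : ℝ} (hC : 0 ≤ C)
    (h : ∀ s (hs : MeasurableSet s), ‖φ (BddMeas.ind hs)‖ ≤ C * p.real s) :
    ∃ g : BddMeas A, (∀ x, ‖g x‖ ≤ 2 * C) ∧ ∀ f, φ f = BddMeas.expect p (f * g) := by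
  classical
  have hadd {s t : Set (ℤ → A)} (hs : MeasurableSet s) (ht : MeasurableSet t) (hst : Disjoint s t) :
      φ (BddMeas.ind (hs.union ht)) = φ (BddMeas.ind hs) + φ (BddMeas.ind ht) := by
    rw [BddMeas.ind_union hs ht hst, map_add]
  obtain ⟨u, hu, huC, hus⟩ := exists_density_of_abs_le p hC
    (fun s => if hs : MeasurableSet s then (φ (BddMeas.ind hs)).re else 0)
    (fun s hs => by
      rw [dif_pos hs]; exact (Complex.abs_re_le_norm _).trans (h s hs))
    (fun s t hs ht hst => by
      rw [dif_pos hs, dif_pos ht, dif_pos (hs.union ht), hadd hs ht hst, Complex.add_re])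
  obtain ⟨v, hv, hvC, hvs⟩ := exists_density_of_abs_le p hC
    (fun s => if hs : MeasurableSet s then (φ (BddMeas.ind hs)).im else 0)
    (fun s hs => by
      rw [dif_pos hs]; exact (Complex.abs_im_le_norm _).trans (h s hs))
    (fun s t hs ht hst => by
      rw [dif_pos hs, dif_pos ht, dif_pos (hs.union ht), hadd hs ht hst, Complex.add_im])
  -- Real and imaginary densities are each bounded by `C`, whence the constant `2 * C`.
  have hbd (x : ℤ → A) : ‖(⟨u x, v x⟩ : ℂ)‖ ≤ 2 * C := by
    refine (Complex.norm_le_abs_re_add_abs_im _).trans ?_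
    have h1 := huC x
    have h2 := hvC x
    simp only
    linarith
  let g : BddMeas A := BddMeas.mk (fun x => ⟨u x, v x⟩)
    (measurable_of_re_im hu hv) (2 * C) hbd
  refine ⟨g, hbd, fun f => ?_⟩
  refine BddMeas.induction (P := fun f => φ f = BddMeas.expect p (f * g))
    (isClosed_eq hφ (BddMeas.isState_expect.continuous.comp (continuous_mul_const g)))
    (fun c s hs => ?_) (fun f₁ f₂ h₁ h₂ => ?_) f
  · rw [smul_mul_assoc, map_smul, map_smul, BddMeas.expect_ind_mul hs]
    congr 1
    have hi : Integrable (g : (ℤ → A) → ℂ) (p.restrict s) := g.integrable.integrableOn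
    refine Complex.ext ?_ ?_
    · rw [← RCLike.re_eq_complex_re, ← integral_re hi]
      exact ((hus s hs).trans (dif_pos hs)).symm
    · rw [← RCLike.im_eq_complex_im, ← integral_im hi]
      exact ((hvs s hs).trans (dif_pos hs)).symm
  · rw [map_add, add_mul, map_add, h₁, h₂]

end Density

/-! ### Pointwise linear versions of almost everywhere linear families. -/

section Versions

open MeasureTheory TopologicalSpace

/-- A bounded additive function on a dense additive subgroup which commutes with `i` on a dense set
extends to a bounded complex linear functional. -/
theorem exists_clm_of_additive {B : Type*} [NormedAddCommGroup B] [NormedSpace ℂ B]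
    (D : Submodule ℤ B) (hD : Dense (D : Set B)) (S : Set B) (hS : Dense S) (hSD : S ⊆ D)
    (hISD : ∀ b ∈ S, Complex.I • b ∈ D) (g : B → ℂ) {K : ℝ} (hK : ∀ b, ‖g b‖ ≤ K * ‖b‖)
    (hadd : ∀ b ∈ D, ∀ c ∈ D, g (b + c) = g b + g c)
    (hI : ∀ b ∈ S, g (Complex.I • b) = Complex.I * g b) :
    ∃ φ : B →L[ℂ] ℂ, ∀ b ∈ D, φ b = g b := by
  let f₀ : D →+ ℂ := AddMonoidHom.mk' (fun b => g b) fun b c => hadd b b.2 c c.2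
  have hf₀ : Continuous f₀ := AddMonoidHomClass.continuous_of_bound f₀ K fun b => hK b
  let f : D →L[ℤ] ℂ := ⟨f₀.toIntLinearMap, hf₀⟩
  let e : D →L[ℤ] B := ⟨D.subtype, continuous_subtype_val⟩
  have hed : DenseRange e := by
    change Dense (Set.range (Subtype.val : D → B))
    rwa [Subtype.range_coe]
  have heu : IsUniformInducing e := isUniformInducing_val _
  let φ := f.extend e
  have hφ (b : B) (hb : b ∈ D) : φ b = g b := ContinuousLinearMap.extend_eq f hed heu ⟨b, hb⟩
  -- A continuous additive map is automatically real linear, so only multiplication by `I` remains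
  -- to be checked, on a dense set. This is why subgroups suffice.
  let φr : B →L[ℝ] ℂ := AddMonoidHom.toRealLinearMap (φ : B →+ ℂ) φ.continuous
  have hφI (b : B) : φ (Complex.I • b) = Complex.I * φ b := by
    refine congrFun (Continuous.ext_on hS (f := fun b => φ (Complex.I • b))
      (g := fun b => Complex.I * φ b) (φ.continuous.comp (continuous_const_smul _))
      (continuous_const.mul φ.continuous) fun b hb => ?_) b
    simp only
    rw [hφ _ (hISD b hb), hφ _ (hSD hb), hI b hb]
  refine ⟨⟨{ toFun := φ, map_add' := map_add φ, map_smul' := fun z b => ?_ }, φ.continuous⟩, hφ⟩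
  have hr (r : ℝ) (c : B) : φ (r • c) = r * φ c := (map_smul φr r c).trans (Complex.real_smul)
  conv_lhs => rw [← Complex.re_add_im z]
  rw [add_smul, mul_smul, map_add, Complex.coe_smul, Complex.coe_smul, hr, hr, hφI]
  simp only [RingHom.id_apply, smul_eq_mul]
  conv_rhs => rw [← Complex.re_add_im z]
  ring

/-- A bounded family of measurable functions indexed linearly, up to null sets, by a separable
space, has a version which is pointwise a bounded linear functional. -/
theorem exists_clm_version {X : Type*} [MeasurableSpace X] (p : Measure X) {B : Type*}
    [NormedAddCommGroup B] [NormedSpace ℂ B] [SeparableSpace B] (g : B → X → ℂ)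
    (hg : ∀ b, Measurable (g b)) {K : ℝ} (hK : ∀ b x, ‖g b x‖ ≤ K * ‖b‖)
    (hadd : ∀ b c, ∀ᵐ x ∂p, g (b + c) x = g b x + g c x)
    (hI : ∀ b, ∀ᵐ x ∂p, g (Complex.I • b) x = Complex.I * g b x) :
    ∃ φ : X → B →L[ℂ] ℂ, (∀ b, Measurable fun x => φ x b) ∧ ∀ b, ∀ᵐ x ∂p, φ x b = g b x := by
  classical
  have : Nonempty B := ⟨0⟩
  let d := denseSeq B
  -- This subgroup is countable and dense, and contains both the dense sequence and its multiples by
  -- `I`; hence only countably many almost everywhere identities have to hold together.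
  let D : Submodule ℤ B := Submodule.span ℤ
    (Set.range (Sum.elim d fun n => Complex.I • d n))
  have hDc : Countable D := inferInstance
  have hSD : Set.range d ⊆ D := by
    rintro _ ⟨n, rfl⟩
    exact Submodule.subset_span ⟨Sum.inl n, rfl⟩
  have hISD : ∀ b ∈ Set.range d, Complex.I • b ∈ D := by
    rintro _ ⟨n, rfl⟩
    exact Submodule.subset_span ⟨Sum.inr n, rfl⟩
  have hS : Dense (Set.range d) := denseRange_denseSeq B
  have hD : Dense (D : Set B) := hS.mono hSD
  let G : Set X := {x | (∀ b c : D, g (b + c) x = g b x + g c x) ∧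
    ∀ n, g (Complex.I • d n) x = Complex.I * g (d n) x}
  have hGm : MeasurableSet G := by
    simp only [G, Set.ofPred_and, Set.ofPred_forall]
    exact MeasurableSet.inter (MeasurableSet.iInter fun b => MeasurableSet.iInter fun c =>
        measurableSet_eq_fun (hg _) ((hg _).add (hg _)))
      (MeasurableSet.iInter fun n => measurableSet_eq_fun (hg _) ((hg _).const_mul _))
  have hG : ∀ᵐ x ∂p, x ∈ G := by
    have h1 : ∀ᵐ x ∂p, ∀ b c : D, g (b + c) x = g b x + g c x :=
      ae_all_iff.2 fun b => ae_all_iff.2 fun c => hadd b c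
    have h2 : ∀ᵐ x ∂p, ∀ n, g (Complex.I • d n) x = Complex.I * g (d n) x :=
      ae_all_iff.2 fun n => hI (d n)
    filter_upwards [h1, h2] with x hx1 hx2
    exact ⟨hx1, hx2⟩
  have hex (x : X) (hx : x ∈ G) : ∃ φ : B →L[ℂ] ℂ, ∀ b ∈ D, φ b = g b x :=
    exists_clm_of_additive D hD _ hS hSD hISD (fun b => g b x) (fun b => hK b x)
      (fun b hb c hc => hx.1 ⟨b, hb⟩ ⟨c, hc⟩) (by rintro _ ⟨n, rfl⟩; exact hx.2 n)
  choose! ψ hψ using hex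
  -- The value zero off the measurable set `G` keeps `φ` measurable.
  let φ : X → B →L[ℂ] ℂ := fun x => if x ∈ G then ψ x else 0
  have hφG {x : X} (hx : x ∈ G) {b : B} (hb : b ∈ D) : φ x b = g b x := by
    simp only [φ, if_pos hx]
    exact hψ x hx b hb
  have hseq (b : B) : ∃ u : ℕ → B, (∀ n, u n ∈ D) ∧ Filter.Tendsto u Filter.atTop (nhds b) :=
    mem_closure_iff_seq_limit.1 (hD b)
  refine ⟨φ, fun b => ?_, fun b => ?_⟩
  · obtain ⟨u, huD, hu⟩ := hseq b
    refine measurable_of_tendsto_metrizable (f := fun n x => φ x (u n)) (fun n => ?_)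
      (tendsto_pi_nhds.2 fun x => ((φ x).continuous.tendsto b).comp hu)
    have h : (fun x => φ x (u n)) = fun x => if x ∈ G then g (u n) x else 0 := by
      funext x
      by_cases hx : x ∈ G
      · rw [hφG hx (huD n), if_pos hx]
      · simp [φ, hx]
    rw [h]
    exact Measurable.ite hGm (hg _) measurable_const
  · obtain ⟨u, huD, hu⟩ := hseq b
    -- Since `G` controls only `D`, a general `b` needs a further null set, off which `g b x` is
    -- compared with `g (u n) x` through the bound on `g (b - u n)`.
    have hdiff : ∀ᵐ x ∂p, ∀ n, g b x = g (u n) x + g (b - u n) x :=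
      ae_all_iff.2 fun n => by
        filter_upwards [hadd (u n) (b - u n)] with x hx
        rwa [add_sub_cancel] at hx
    filter_upwards [hdiff, hG] with x hx hxG
    refine tendsto_nhds_unique (((φ x).continuous.tendsto b).comp hu) ?_
    rw [tendsto_iff_norm_sub_tendsto_zero]
    refine squeeze_zero (fun _ => norm_nonneg _) (fun n => ?_)
      (g := fun n => K * ‖b - u n‖) ?_
    · rw [Function.comp_apply, hφG hxG (huD n), hx n, sub_add_cancel_left, norm_neg]
      exact hK _ _
    · simpa using ((tendsto_const_nhds (x := b)).sub hu).norm.const_mul K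

end Versions

/-! ### Separability of the quasi-local algebra. -/

section Separability

open scoped Matrix.Norms.L2Operator
open TopologicalSpace

/-- There are countably many finite subsets of `ℤ`, each local algebra is finite-dimensional, and
their union is dense. -/
instance (d : ℕ) [NeZero d] : SeparableSpace (QuasiLocal d) := by
  have h (Λ : Finset ℤ) : IsSeparable (Set.range (ofLocal d Λ)) := by
    have : ProperSpace (LocalAlg d Λ) := FiniteDimensional.proper ℂ _
    exact isSeparable_range
      (AddMonoidHomClass.isometry_of_norm (ofLocal d Λ) (norm_ofLocal d Λ)).continuous
  have hU : IsSeparable {b : QuasiLocal d | ∃ Λ M, ofLocal d Λ M = b} := by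
    convert IsSeparable.iUnion h using 1
    ext b
    simp
  have := hU.closure
  rwa [(dense_ofLocal d).closure_eq, isSeparable_univ_iff] at this

end Separability

/-! ### Exactly invariant sets of full measure. -/

section InvariantSets

open MeasureTheory

variable {A : Type*}

/-- The power of the shift which moves the origin to `n`. -/
def shiftBy (n : ℤ) (x : ℤ → A) : ℤ → A := fun k => x (k + n)

theorem shiftBy_shiftIn (n : ℤ) (x : ℤ → A) : shiftBy n (shiftIn x) = shiftBy (n + 1) x :=
  funext fun k => congrArg x (add_assoc k n 1)

theorem shiftIn_shiftBy (n : ℤ) (x : ℤ → A) : shiftIn (shiftBy n x) = shiftBy (n + 1) x :=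
  funext fun k => congrArg x (by ring)

theorem shiftBy_neg_one_shiftIn (x : ℤ → A) : shiftBy (-1) (shiftIn x) = x :=
  funext fun k => congrArg x (by ring)

variable [MeasurableSpace A]

theorem measurable_shiftBy (n : ℤ) : Measurable (shiftBy (A := A) n) :=
  measurable_pi_lambda _ fun k => measurable_pi_apply (k + n)

theorem measurePreserving_shiftBy {p : Measure (ℤ → A)} (hp : MeasurePreserving shiftIn p p)
    (n : ℤ) : MeasurePreserving (shiftBy n) p p := by
  have hneg : MeasurePreserving (shiftBy (-1)) p p := by
    refine ⟨measurable_shiftBy _, ?_⟩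
    conv_lhs => rw [← hp.map_eq]
    rw [Measure.map_map (measurable_shiftBy _) hp.measurable]
    convert Measure.map_id
    exact funext shiftBy_neg_one_shiftIn
  induction n with
  | zero =>
    convert MeasurePreserving.id p
    exact funext fun x => funext fun k => congrArg x (add_zero k)
  | succ n ih =>
    convert hp.comp ih using 1
    exact funext fun x => (shiftIn_shiftBy _ x).symm
  | pred n ih =>
    convert hneg.comp ih using 1
    exact funext fun x => funext fun k => congrArg x (by ring)

/-- The complement of a measurable null set is intersected with all its translates, by both positive
and negative shifts. Exact invariance is needed because stationarity of a channel is required at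
every point. -/
theorem exists_invariant_of_ae {p : Measure (ℤ → A)} (hp : MeasurePreserving shiftIn p p)
    {P : (ℤ → A) → Prop} (hP : ∀ᵐ x ∂p, P x) :
    ∃ G : Set (ℤ → A), MeasurableSet G ∧ (∀ x, shiftIn x ∈ G ↔ x ∈ G) ∧ (∀ x ∈ G, P x) ∧
      ∀ᵐ x ∂p, x ∈ G := by
  obtain ⟨N, hPN, hN, hpN⟩ := exists_measurable_superset_of_null (ae_iff.1 hP)
  refine ⟨⋂ n, shiftBy n ⁻¹' Nᶜ, MeasurableSet.iInter fun n => measurable_shiftBy n hN.compl,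
    fun x => ?_, fun x hx => ?_, ?_⟩
  · simp only [Set.mem_iInter, Set.mem_preimage, shiftBy_shiftIn]
    exact ⟨fun h n => by simpa using h (n - 1), fun h n => h (n + 1)⟩
  · by_contra hx'
    have h0 := Set.mem_iInter.1 hx 0
    rw [Set.mem_preimage, show shiftBy 0 x = x from
      funext fun k => congrArg x (add_zero k)] at h0
    exact h0 (hPN hx')
  · simp only [Set.mem_iInter]
    exact ae_all_iff.2 fun n =>
      (measurePreserving_shiftBy hp n).quasiMeasurePreserving.ae (compl_mem_ae_iff.2 hpN)

end InvariantSets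

/-! ### Disintegration of stationary states, and extremal channels are ergodic. -/

section Disintegration

open MeasureTheory TopologicalSpace

variable {A : Type*} [MeasurableSpace A] {B : Type*} [CStarAlgebra B]

/-- The factor `(φ 1).re` is the point: for `φ = χ(1_s ⊗ ·)` it is the marginal mass of `s`, which
turns domination of the marginal into domination for every `b`. The `4` counts the positive parts of
`b`. -/
theorem norm_le_of_positive {φ : B →ₗ[ℂ] ℂ} (hφ : ∀ b, 0 ≤ φ (star b * b)) (b : B) :
    ‖φ b‖ ≤ 4 * ‖b‖ * (φ 1).re := by
  have h1 : 0 ≤ φ 1 := by simpa using hφ 1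
  have hre : ‖φ 1‖ = (φ 1).re := by
    rw [← Complex.ofReal_inj, Complex.norm_of_nonneg' h1]
    exact Complex.eq_re_of_ofReal_le h1
  let _ := CStarAlgebra.spectralOrder B
  let _ := CStarAlgebra.spectralOrderedRing B
  let Φ : B →ₚ[ℂ] ℂ := PositiveLinearMap.mk₀ φ fun x hx => by
    obtain ⟨s, rfl⟩ := CStarAlgebra.nonneg_iff_eq_star_mul_self.1 hx
    exact hφ s
  have hΦ (x : B) (hx : 0 ≤ x) : ‖φ x‖ ≤ (φ 1).re * ‖x‖ :=
    hre ▸ Φ.norm_apply_le_of_nonneg x hx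
  obtain ⟨y, hy, hyn, hb⟩ := CStarAlgebra.exists_sum_four_nonneg b
  rw [congrArg φ hb, map_sum]
  refine (norm_sum_le _ _).trans ((Finset.sum_le_sum (g := fun _ => (φ 1).re * ‖b‖)
    fun i _ => ?_).trans ?_)
  · rw [map_smul, norm_smul, norm_pow, Complex.norm_I, one_pow, one_mul]
    exact (hΦ _ (hy i)).trans
      (mul_le_mul_of_nonneg_left (hyn i) (hre ▸ norm_nonneg _))
  · rw [Fin.sum_const]
    exact (by simp; ring : _ = 4 * ‖b‖ * (φ 1).re).le

theorem integrable_of_isState {p : Measure (ℤ → A)} [IsProbabilityMeasure p]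
    {φ : (ℤ → A) → B →L[ℂ] ℂ} (hφ : ∀ b, Measurable fun x => φ x b)
    (hs : ∀ᵐ x ∂p, IsState (φ x : B →ₗ[ℂ] ℂ)) (b : B) : Integrable (fun x => φ x b) p :=
  Integrable.of_bound (hφ b).aestronglyMeasurable (4 * ‖b‖) (hs.mono fun _ hx => hx.norm_le b)

theorem BddMeas.ae_nonneg {p : Measure (ℤ → A)} [IsProbabilityMeasure p] {u : BddMeas A}
    (h : ∀ s (hs : MeasurableSet s), 0 ≤ expect p (ind hs * u)) : ∀ᵐ x ∂p, 0 ≤ u x := by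
  have hi : Integrable (u : (ℤ → A) → ℂ) p := u.integrable
  have hre : 0 ≤ᵐ[p] fun x => (u x).re :=
    ae_nonneg_of_forall_setIntegral_nonneg hi.re fun s hs _ => by
      have := (Complex.nonneg_iff.1 (h s hs)).1
      rw [expect_ind_mul, ← RCLike.re_eq_complex_re, ← integral_re hi.integrableOn] at this
      exact this
  have him : (fun x => (u x).im) =ᵐ[p] 0 :=
    hi.im.ae_eq_zero_of_forall_setIntegral_eq_zero fun s hs _ => by
      have := (Complex.nonneg_iff.1 (h s hs)).2
      rw [expect_ind_mul, ← RCLike.im_eq_complex_im, ← integral_im hi.integrableOn] at this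
      exact this.symm
  filter_upwards [hre, him] with x h1 h2
  exact Complex.nonneg_iff.2 ⟨h1, h2.symm⟩

/-- The inverse of the shift on bounded measurable functions. -/
theorem BddMeas.exists_shift_eq (f : BddMeas A) : ∃ f' : BddMeas A, f'.shift = f :=
  ⟨mk (fun x => f (shiftBy (-1) x)) (f.measurable.comp (measurable_shiftBy _)) ‖f‖
    fun _ => f.norm_apply_le _, ext fun x => congrArg f (shiftBy_neg_one_shiftIn x)⟩

namespace Joint

variable [Nontrivial B]

/-- The continuous linear map `f ↦ f ⊗ b`. -/
def tmulRight (b : B) : BddMeas A →L[ℂ] Joint A B :=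
  LinearMap.mkContinuous
    { toFun := fun f => tmul f b
      map_add' := fun f g => ext fun x =>
        (tmul_apply (f + g) b x).trans ((add_smul (f x) (g x) b).trans
          (congrArg₂ (· + ·) (tmul_apply f b x) (tmul_apply g b x)).symm)
      map_smul' := fun r f => ext fun x =>
        (tmul_apply (r • f) b x).trans ((smul_assoc r (f x) b).trans
          (congrArg (r • ·) (tmul_apply f b x)).symm) }
    ‖b‖ fun f => lp.norm_le_of_forall_le (by positivity) fun x => by
      change ‖tmul f b x‖ ≤ _
      rw [tmul_apply, norm_smul, mul_comm]
      exact mul_le_mul_of_nonneg_left (f.norm_apply_le x) (norm_nonneg b)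

/-- The linear map `b ↦ f ⊗ b`. -/
def tmulLeft (f : BddMeas A) : B →ₗ[ℂ] Joint A B where
  toFun b := tmul f b
  map_add' b c := ext fun x => (tmul_apply f (b + c) x).trans ((smul_add (f x) b c).trans
    (congrArg₂ (· + ·) (tmul_apply f b x) (tmul_apply f c x)).symm)
  map_smul' r b := ext fun x => (tmul_apply f (r • b) x).trans ((smul_comm (f x) r b).trans
    (congrArg (r • ·) (tmul_apply f b x)).symm)

theorem star_tmul_mul_tmul (f : BddMeas A) (b : B) :
    star (tmul f b) * tmul f b = tmul (star f * f) (star b * b) := by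
  refine ext fun x => ?_
  change star (tmul f b x) * tmul f b x = _
  rw [tmul_apply, tmul_apply, star_smul, smul_mul_smul_comm]
  rfl

theorem tmul_one_one : (tmul 1 1 : Joint A B) = 1 :=
  ext fun x => (tmul_apply 1 1 x).trans (one_smul ℂ (1 : B))

end Joint

/-- A stationary state on the joint algebra whose input marginal is dominated by an ergodic measure
is the joint state of an almost everywhere defined stationary channel. -/
theorem exists_conditional_states [SeparableSpace B] [Nontrivial B] {T : B →⋆ₐ[ℂ] B}
    {p : Measure (ℤ → A)} [IsProbabilityMeasure p] (hp : Ergodic shiftIn p)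
    {χ : Joint A B →ₗ[ℂ] ℂ} (hχ : χ ∈ stationaryStates (Joint.shift T)) {C : ℝ} (hC0 : 0 ≤ C)
    (hC : ∀ s (hs : MeasurableSet s), (χ (Joint.tmul (BddMeas.ind hs) 1)).re ≤ C * p.real s) :
    ∃ φ : (ℤ → A) → B →L[ℂ] ℂ, (∀ b, Measurable fun x => φ x b) ∧
      (∀ (f : BddMeas A) b, χ (Joint.tmul f b) = ∫ x, f x * φ x b ∂p) ∧
      (∀ᵐ x ∂p, IsState (φ x : B →ₗ[ℂ] ℂ)) ∧
      ∀ᵐ x ∂p, ∀ b, φ (shiftIn x) b = φ x (T b) := by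
  have hmp := hp.toMeasurePreserving
  have hpos (s : Set (ℤ → A)) (hs : MeasurableSet s) (b : B) :
      0 ≤ χ (Joint.tmul (BddMeas.ind hs) (star b * b)) := by
    have := hχ.1.1 (Joint.tmul (BddMeas.ind hs) b)
    rwa [Joint.star_tmul_mul_tmul, BddMeas.star_ind_mul_ind] at this
  have hbound (b : B) (s : Set (ℤ → A)) (hs : MeasurableSet s) :
      ‖χ (Joint.tmul (BddMeas.ind hs) b)‖ ≤ 4 * ‖b‖ * C * p.real s := by
    have := norm_le_of_positive (φ := χ ∘ₗ Joint.tmulLeft (BddMeas.ind hs))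
      (fun b => hpos s hs b) b
    refine this.trans ?_
    rw [mul_assoc _ C]
    exact mul_le_mul_of_nonneg_left (hC s hs) (by positivity)
  have hdens (b : B) := exists_density_of_norm_le p (χ ∘ₗ (Joint.tmulRight b).toLinearMap)
    (hχ.1.continuous.comp (Joint.tmulRight b).continuous) (C := 4 * ‖b‖ * C) (by positivity)
    (hbound b)
  choose g hgn hg using hdens
  replace hg (b : B) (f : BddMeas A) : χ (Joint.tmul f b) = BddMeas.expect p (f * g b) := hg b f
  obtain ⟨φ, hφm, hφ⟩ := exists_clm_version p (fun b x => g b x) (fun b => (g b).measurable)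
    -- The density of `χ(· ⊗ b)` is bounded by twice its domination constant `4 * ‖b‖ * C`.
    (K := 8 * C) (fun b x => (hgn b x).trans_eq (by ring))
    (fun b c => BddMeas.ae_eq_of_forall_expect_mul_eq (v := g b + g c) fun f => by
      rw [← hg, mul_add, map_add, ← hg, ← hg, ← map_add]
      exact congrArg χ (map_add (Joint.tmulLeft f) b c))
    (fun b => BddMeas.ae_eq_of_forall_expect_mul_eq (v := Complex.I • g b) fun f => by
      rw [← hg, mul_smul_comm, map_smul, ← hg, ← map_smul]
      exact congrArg χ (map_smul (Joint.tmulLeft f) Complex.I b))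
  have hrep (f : BddMeas A) (b : B) : χ (Joint.tmul f b) = ∫ x, f x * φ x b ∂p := by
    rw [hg]
    refine integral_congr_ae ?_
    filter_upwards [hφ b] with x hx
    exact congrArg (f x * ·) hx.symm
  have hshift (b : B) : ∀ᵐ x ∂p, φ (shiftIn x) b = φ x (T b) := by
    have h1 : ∀ᵐ x ∂p, (g b).shift x = g (T b) x :=
      BddMeas.ae_eq_of_forall_expect_mul_eq fun f => by
        -- Every test function is itself a shift, so the joint stationarity of `χ` and the
        -- invariance of `p` can be applied.
        obtain ⟨f', rfl⟩ := f.exists_shift_eq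
        rw [← hg, ← Joint.shift_tmul, hχ.2, hg]
        exact BddMeas.expect_shift hmp (f' * g b)
    filter_upwards [h1, hφ (T b), hmp.quasiMeasurePreserving.ae (hφ b)] with x hx1 hx2 hx3
    rw [hx2, hx3, ← hx1]
    rfl
  have hshift' : ∀ᵐ x ∂p, ∀ b, φ (shiftIn x) b = φ x (T b) := by
    filter_upwards [ae_all_iff.2 fun n => hshift (denseSeq B n)] with x hx
    refine congrFun (Continuous.ext_on (denseRange_denseSeq B) (φ (shiftIn x)).continuous
      ((φ x).continuous.comp (AddMonoidHomClass.continuous_of_bound T 1 fun a => ?_)) ?_)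
    · rw [one_mul]; exact NonUnitalStarAlgHom.norm_apply_le T a
    · rintro _ ⟨n, rfl⟩
      exact hx n
  have hstate1 (b : B) : ∀ᵐ x ∂p, 0 ≤ φ x (star b * b) := by
    have h1 : ∀ᵐ x ∂p, 0 ≤ g (star b * b) x := BddMeas.ae_nonneg fun s hs => by
      rw [← hg]
      exact hpos s hs b
    filter_upwards [h1, hφ (star b * b)] with x hx1 hx2
    rwa [hx2]
  -- The function `x ↦ φ x 1` is the density of the input marginal. It is invariant, hence constant
  -- by ergodicity, and its integral is `χ 1 = 1`.
  have hone : ∀ᵐ x ∂p, φ x 1 = 1 := by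
    have hinv : (fun x => φ x 1) ∘ shiftIn =ᵐ[p] fun x => φ x 1 := by
      filter_upwards [hshift 1] with x hx
      simpa using hx
    obtain ⟨c, hc⟩ := hp.quasiErgodic.ae_eq_const_of_ae_eq_comp₀
      (hφm 1).nullMeasurable hinv
    have hc1 : c = 1 := by
      have h1 := hrep 1 1
      rw [Joint.tmul_one_one, hχ.1.2] at h1
      have h2 : ∫ x, (1 : BddMeas A) x * φ x 1 ∂p = ∫ _, c ∂p := by
        refine integral_congr_ae ?_
        filter_upwards [hc] with x hx
        exact (one_mul _).trans hx
      rw [h2] at h1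
      simpa using h1.symm
    filter_upwards [hc] with x hx
    rw [hx, hc1]
    rfl
  refine ⟨φ, hφm, hrep, ?_, hshift'⟩
  filter_upwards [ae_all_iff.2 fun n => hstate1 (denseSeq B n), hone] with x hx1 hx2
  refine ⟨fun b => ?_, hx2⟩
  refine (denseRange_denseSeq B).induction_on (p := fun b => 0 ≤ φ x (star b * b)) b
    (isClosed_le continuous_const
      ((φ x).continuous.comp (continuous_star.mul continuous_id))) hx1

open scoped Classical in
/-- The channel which is given by the states `φ x` on `G` and by `W` elsewhere. -/
def CQChannel.modify (W : CQChannel A B) {G : Set (ℤ → A)} (hG : MeasurableSet G)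
    (φ : (ℤ → A) → B →L[ℂ] ℂ) (hφ : ∀ b, Measurable fun x => φ x b)
    (hs : ∀ x ∈ G, IsState (φ x : B →ₗ[ℂ] ℂ)) : CQChannel A B where
  toFun x := if x ∈ G then (φ x : B →ₗ[ℂ] ℂ) else W.toFun x
  measurable b := by
    have h : (fun x => (if x ∈ G then (φ x : B →ₗ[ℂ] ℂ) else W.toFun x) b) =
        fun x => if x ∈ G then φ x b else W.toFun x b := by
      funext x
      split_ifs <;> rfl
    rw [h]
    exact Measurable.ite hG (hφ b) (W.measurable b)
  isState x := by
    split_ifs with hx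
    exacts [hs x hx, W.isState x]

/-- As `G` is exactly invariant, `x` and `shiftIn x` always fall under the same case of the
definition. -/
theorem CQChannel.IsStationary.modify {T : B →⋆ₐ[ℂ] B} {W : CQChannel A B}
    (hW : W.IsStationary T) {G : Set (ℤ → A)} (hG : MeasurableSet G)
    {φ : (ℤ → A) → B →L[ℂ] ℂ} (hφ : ∀ b, Measurable fun x => φ x b)
    (hs : ∀ x ∈ G, IsState (φ x : B →ₗ[ℂ] ℂ)) (hGT : ∀ x, shiftIn x ∈ G ↔ x ∈ G)
    (hφT : ∀ x ∈ G, ∀ b, φ (shiftIn x) b = φ x (T b)) :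
    (W.modify hG φ hφ hs).IsStationary T := by
  have hmem {x : ℤ → A} (hx : x ∈ G) : (W.modify hG φ hφ hs).toFun x = (φ x : B →ₗ[ℂ] ℂ) :=
    if_pos hx
  have hnotMem {x : ℤ → A} (hx : x ∉ G) : (W.modify hG φ hφ hs).toFun x = W.toFun x :=
    if_neg hx
  intro x b
  by_cases hx : x ∈ G
  · rw [hmem hx, hmem ((hGT x).2 hx)]
    exact hφT x hx b
  · rw [hnotMem hx, hnotMem fun h => hx ((hGT x).1 h)]
    exact hW x b

/-- An extremal stationary channel is ergodic. -/
theorem CQChannel.isErgodic_of_isExtremalIn [SeparableSpace B] [Nontrivial B] {T : B →⋆ₐ[ℂ] B}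
    {W : CQChannel A B} (hW : W.IsStationary T)
    (hext : IsExtremalIn ChannelEq (stationaryChannels A T) W.toFun) : W.IsErgodic T := by
  classical
  refine ⟨hW, fun p _ hp => ?_⟩
  have hmp := hp.toMeasurePreserving
  refine mem_extremePoints_iff_left.2 ⟨hW.jointState_mem hmp, ?_⟩
  rintro ψ₁ hψ₁ ψ₂ hψ₂ ⟨a, b, ha, hb, hab, hψ⟩
  have hψ' (f : BddMeas A) (c : B) : a • ψ₁ (Joint.tmul f c) + b • ψ₂ (Joint.tmul f c) =
      BddMeas.expect p (f * W.mapK c) := by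
    rw [← mapE_tmul]
    exact LinearMap.congr_fun hψ (Joint.tmul f c)
  have hnn {ψ : Joint A B →ₗ[ℂ] ℂ} (h : IsState ψ) (s : Set (ℤ → A)) (hs : MeasurableSet s) :
      0 ≤ (ψ (Joint.tmul (BddMeas.ind hs) 1)).re := by
    have := h.1 (Joint.tmul (BddMeas.ind hs) 1)
    rw [Joint.star_tmul_mul_tmul, BddMeas.star_ind_mul_ind, star_one, one_mul] at this
    exact (Complex.nonneg_iff.1 this).1
  -- The marginals of `ψ₁` and `ψ₂` average to `p`, so they are dominated by `a⁻¹ p` and `b⁻¹ p`.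
  have hmarg (s : Set (ℤ → A)) (hs : MeasurableSet s) :
      a * (ψ₁ (Joint.tmul (BddMeas.ind hs) 1)).re + b * (ψ₂ (Joint.tmul (BddMeas.ind hs) 1)).re =
        p.real s := by
    have h := congrArg Complex.re (hψ' (BddMeas.ind hs) 1)
    rw [BddMeas.expect_ind_mul hs] at h
    have h1 : ∀ x, W.mapK 1 x = 1 := fun x => (W.isState x).2
    simpa [h1] using h
  obtain ⟨φ₁, hφ₁m, hφ₁, hφ₁s, hφ₁T⟩ := exists_conditional_states hp hψ₁ (inv_nonneg.2 ha.le)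
    fun s hs => by
      rw [le_inv_mul_iff₀ ha, ← hmarg s hs]
      exact le_add_of_nonneg_right (mul_nonneg hb.le (hnn hψ₂.1 s hs))
  obtain ⟨φ₂, hφ₂m, hφ₂, hφ₂s, hφ₂T⟩ := exists_conditional_states hp hψ₂ (inv_nonneg.2 hb.le)
    fun s hs => by
      rw [le_inv_mul_iff₀ hb, ← hmarg s hs]
      exact le_add_of_nonneg_left (mul_nonneg ha.le (hnn hψ₁.1 s hs))
  have hcomb1 (c : B) : ∀ᵐ x ∂p, a • φ₁ x c + b • φ₂ x c = W.toFun x c := by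
    have hi₁ := (integrable_of_isState hφ₁m hφ₁s c).smul a
    have hi₂ := (integrable_of_isState hφ₂m hφ₂s c).smul b
    refine Integrable.ae_eq_of_forall_setIntegral_eq _ _ (hi₁.add hi₂) (W.mapK c).integrable
      fun s hs _ => ?_
    refine Eq.trans ?_ (BddMeas.expect_ind_mul hs (W.mapK c))
    rw [← hψ', hφ₁, hφ₂, BddMeas.integral_ind_mul, BddMeas.integral_ind_mul, ← integral_smul, ← integral_smul]
    exact integral_add hi₁.integrableOn hi₂.integrableOn
  have hcomb : ∀ᵐ x ∂p, ∀ c, a • φ₁ x c + b • φ₂ x c = W.toFun x c := by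
    filter_upwards [ae_all_iff.2 fun n => hcomb1 (denseSeq B n)] with x hx
    refine congrFun (Continuous.ext_on (denseRange_denseSeq B)
      (((φ₁ x).continuous.const_smul a).add ((φ₂ x).continuous.const_smul b))
      (W.isState x).continuous ?_)
    rintro _ ⟨n, rfl⟩
    exact hx n
  -- All almost everywhere properties are made to hold everywhere on one invariant set; off it both
  -- new channels equal `W`, so the convex combination is exact at every point.
  obtain ⟨G, hG, hGT, hGP, hGp⟩ := exists_invariant_of_ae hmp
    (hφ₁s.and (hφ₂s.and (hφ₁T.and (hφ₂T.and hcomb))))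
  let W₁ := W.modify hG φ₁ hφ₁m fun x hx => (hGP x hx).1
  let W₂ := W.modify hG φ₂ hφ₂m fun x hx => (hGP x hx).2.1
  have hW₁ : W₁.IsStationary T := hW.modify hG hφ₁m _ hGT fun x hx => (hGP x hx).2.2.1
  have hW₂ : W₂.IsStationary T := hW.modify hG hφ₂m _ hGT fun x hx => (hGP x hx).2.2.2.1
  have hWcomb : W.toFun = a • W₁.toFun + (1 - a) • W₂.toFun := by
    obtain rfl : b = 1 - a := eq_sub_of_add_eq' hab
    funext x
    refine LinearMap.ext fun c => ?_
    change _ = a • (if x ∈ G then (φ₁ x : B →ₗ[ℂ] ℂ) else W.toFun x) c +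
      (1 - a) • (if x ∈ G then (φ₂ x : B →ₗ[ℂ] ℂ) else W.toFun x) c
    split_ifs with hx
    · exact ((hGP x hx).2.2.2.2 c).symm
    · rw [← add_smul, hab, one_smul]
  have h12 := hext.2 _ ⟨W₁, hW₁, rfl⟩ _ ⟨W₂, hW₂, rfl⟩ a ⟨ha, by linarith⟩
    (hWcomb ▸ fun _ _ _ _ _ => rfl)
  -- Equality of `W₁` and `W₂` is tested at `p` alone, where `G` has full measure and the channels
  -- represent `ψ₁` and `ψ₂`.
  have hψ12 : ψ₁ = ψ₂ := by
    refine Joint.linearMap_eq hψ₁.1.continuous hψ₂.1.continuous fun f c => ?_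
    rw [hφ₁, hφ₂]
    refine Eq.trans ?_ ((h12 p hmp f c).trans ?_)
    · refine integral_congr_ae ?_
      filter_upwards [hGp] with x hx
      simp [W₁, CQChannel.modify, hx]
    · refine integral_congr_ae ?_
      filter_upwards [hGp] with x hx
      simp [W₂, CQChannel.modify, hx]
  rw [← hψ, ← hψ12, ← add_smul, hab, one_smul]

end Disintegration

end CQ

end

theorem mainTheorem6 {A : Type*} [Finite A] [MeasurableSpace A] [DiscreteMeasurableSpace A]
    (d : ℕ) [NeZero d] (W : CQ.CQChannel A (CQ.QuasiLocal d))
    (hW : W.IsStationary (CQ.shiftOut d)) :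
    List.TFAE
      [ W.IsErgodic (CQ.shiftOut d),
        CQ.IsExtremalIn CQ.ChannelEq (CQ.stationaryChannels A (CQ.shiftOut d)) W.toFun,
        CQ.IsExtremalIn CQ.MapKEq (CQ.setK A (CQ.shiftOut d)) W.mapK,
        CQ.IsExtremalIn CQ.MapEEq (CQ.setE A (CQ.shiftOut d)) W.mapE ] := by
  tfae_have 1 → 2 := fun h => h.isExtremalIn
  tfae_have 2 → 1 := fun h => CQ.CQChannel.isErgodic_of_isExtremalIn hW h
  tfae_have 3 ↔ 2 := CQ.isExtremalIn_setK_iff hW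
  tfae_have 4 ↔ 3 := CQ.isExtremalIn_setE_iff hW
  tfae_finish
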